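/- For $F\subseteq\mathbb{R}^m$ let $\mathrm{pix}(F)$ be the set of all $z\in\mathbb{Z}^m$ such that $F$ meets the cube $[z_1,z_1+1)\times\cdots\times[z_m,z_m+1)$, and let $$\mathrm{Dim}_{\rm M}(F):=\limsup_{n\to\infty}\frac1n\log_2\Big(\max\big\{2,\,\big|\mathrm{pix}(F)\cap[-2^n,2^n)^m\big|\big\}\Big)$$ be the macroscopic Minkowski dimension of $F$. Let $X=\{X_t\}_{t\ge0}$ be a Lévy process on $\mathbb{R}^d$, that is, a process with $X_0=0$ almost surely, with stationary and independent increments, and with almost surely càdlàg paths. Let $\mathcal{G}_X:=\{(t,X_t):t\ge0\}\subseteq\mathbb{R}^{d+1}$ be its graph. If $X_1$ is integrable and $\mathrm{E}(X_1)=0$, then $$\mathrm{Dim}_{\rm M}(\mathcal{G}_X)=1\qquad\text{almost surely.}$$ Moreover, if $B$ is a standard one-dimensional Brownian motion, then almost surely $\mathrm{Dim}_{\rm M}(\mathcal{G}_B)=1$, whereas the (microscopic) Hausdorff dimension of $\mathcal{G}_B$ is $\dim_{\rm H}(\mathcal{G}_B)=3/2$. -/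

import Mathlib

open MeasureTheory ProbabilityTheory Filter Topology
open scoped NNReal ENNReal

namespace MacroDim

/-- The half-open box `B(x; r) = [x₁ - r, x₁ + r) × ⋯ × [x_m - r, x_m + r)`. -/
def box {m : ℕ} (x : EuclideanSpace ℝ (Fin m)) (r : ℝ) : Set (EuclideanSpace ℝ (Fin m)) :=
  {y | ∀ i, y i ∈ Set.Ico (x i - r) (x i + r)}

/-- The half-open unit cube `Q(x) = [x₁, x₁ + 1) × ⋯ × [x_m, x_m + 1)`. -/
def unitCube {m : ℕ} (x : EuclideanSpace ℝ (Fin m)) : Set (EuclideanSpace ℝ (Fin m)) :=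
  {y | ∀ i, y i ∈ Set.Ico (x i) (x i + 1)}

/-- The inclusion of the integer lattice `ℤ^m` into `ℝ^m`. -/
noncomputable def latticePt {m : ℕ} (z : Fin m → ℤ) : EuclideanSpace ℝ (Fin m) :=
  WithLp.toLp 2 fun i => (z i : ℝ)

/-- The pixelization `pix F ⊆ ℤ^m`: the lattice points `z` such that `F` meets `Q(z)`. -/
def pix {m : ℕ} (F : Set (EuclideanSpace ℝ (Fin m))) : Set (Fin m → ℤ) :=
  {z | (F ∩ unitCube (latticePt z)).Nonempty}

/-- `Log₊ y = log₂ (max y 2)`. -/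
noncomputable def logPlus (y : ℝ) : ℝ := Real.logb 2 (max y 2)

/-- The macroscopic Minkowski dimension
`limsup_{n → ∞} n⁻¹ Log₊ |pix F ∩ B(0; 2^n)|` of a set `F ⊆ ℝ^m`.
The limsup is taken in the extended reals; the sets that are counted are finite. -/
noncomputable def dimM {m : ℕ} (F : Set (EuclideanSpace ℝ (Fin m))) : EReal :=
  limsup (fun n : ℕ =>
    (((n : ℝ)⁻¹ * logPlus ((pix F ∩ latticePt ⁻¹' box 0 (2 ^ n)).ncard : ℝ) : ℝ) : EReal)) atTop

/-- A path is càdlàg: right-continuous with left limits at every time `t ≥ 0`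
(at `t = 0` the left-limit condition is vacuous). -/
def IsCadlag {E : Type*} [TopologicalSpace E] (f : ℝ≥0 → E) : Prop :=
  ∀ t, ContinuousWithinAt f (Set.Ici t) t ∧ ∃ l, Tendsto f (𝓝[<] t) (𝓝 l)

/-- `X` is a Lévy process on `ℝ^d` under `P`: it starts at `0`, has stationary and independent
increments, and has càdlàg paths (the first and the last almost surely). Such a process
automatically has the strong Markov property. -/
structure IsLevyProcess {Ω : Type*} [MeasurableSpace Ω] {d : ℕ}
    (X : ℝ≥0 → Ω → EuclideanSpace ℝ (Fin d)) (P : Measure Ω) : Prop where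
  measurable : ∀ t, Measurable (X t)
  zero : ∀ᵐ ω ∂P, X 0 ω = 0
  indep : HasIndepIncrements X P
  stationary : ∀ s t : ℝ≥0, IdentDistrib (fun ω => X (s + t) ω - X s ω) (X t) P P
  cadlag : ∀ᵐ ω ∂P, IsCadlag fun t => X t ω

/-- The point `(t, x) ∈ ℝ^{d+1}` for `t ≥ 0` and `x ∈ ℝ^d`. -/
noncomputable def spaceTime {d : ℕ} (t : ℝ≥0) (x : EuclideanSpace ℝ (Fin d)) :
    EuclideanSpace ℝ (Fin (d + 1)) :=
  WithLp.toLp 2 (Fin.cons (t : ℝ) fun i => x i)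

/-- The graph `{(t, X_t(ω)) : t ≥ 0} ⊆ ℝ^{d+1}` of the path `t ↦ X_t(ω)`. -/
def graph {Ω : Type*} {d : ℕ} (X : ℝ≥0 → Ω → EuclideanSpace ℝ (Fin d)) (ω : Ω) :
    Set (EuclideanSpace ℝ (Fin (d + 1))) :=
  Set.range fun t : ℝ≥0 => spaceTime t (X t ω)

end MacroDim

/-!
The proof rests on one estimate, used both for the macroscopic dimension and, after Brownian
rescaling, for the upper bound on the Hausdorff dimension: a Lévy process visits on average at most
a constant number of unit lattice cubes per unit of time
(`IsLevyProcess.lintegral_hitCount_le`). Indeed, after first hitting a cube the process is likely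
to spend a fixed amount of time near it, while the total time spent near all the cubes is at most
`5 ^ d` times the elapsed time, since every point is near at most `5 ^ d` cubes. On a dyadic grid of
times this needs only independence of increments and the first hitting time of a discrete walk
(`measure_hit_mul_le_sum_measure_mem`); right-continuity of the paths lets the mesh tend to `0`.
No moment assumption is involved.

*Macroscopic dimension.* The cubes of `pix (graph X ω)` in the box of radius `2 ^ n` lie over
`2 ^ n` unit time intervals, so their expected number is `O(2 ^ n)`, and almost surely their number
is `O(n ^ 2 * 2 ^ n)`. In the other direction, the strong law of large numbers gives
`X n / n → 0`, so for large `n` the graph has a point in the box over each integer time below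
`2 ^ n`; hence there are at least `2 ^ n` cubes.

*Hausdorff dimension, upper bound.* Applied to the Brownian motion `2 ^ n * B (t / 4 ^ n)`, with a
constant independent of `n`, the estimate shows that the graph of `B` over `[0, M)` meets on average
`O(4 ^ n)` rectangles of size `4 ^ (-n) × 2 ^ (-n)`, hence is covered by `O(8 ^ n)` squares of side
`4 ^ (-n)`. By Fatou's lemma its `s`-dimensional Hausdorff measure vanishes for `s > 3 / 2`
(`ae_hausdorffMeasure_graph_Iio_eq_zero`).

*Hausdorff dimension, lower bound.* Let `1 ≤ s < 3 / 2` and `b = s - 1 / 2 < 1`. The distance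
between two points of the graph is at least the distance in time and the distance in space, so its
power `-s` is at most `|t - r| ^ (-(s - b)) * |B t - B r| ^ (-b)`, whose expectation is a constant
times `|t - r| ^ (-(s - b / 2))` by Gaussian scaling. As `s - b / 2 < 1`, this is integrable on the
unit square: the occupation measure of the graph has finite `s`-energy almost surely, and a set
carrying such a measure has dimension at least `s` (`le_dimH_of_energy_ne_top`).

`IsBrownianReal` provides coordinates that are only almost everywhere measurable and paths that are
only almost surely continuous. The Brownian statements are therefore proved for an indistinguishable
process with measurable coordinates and everywhere continuous paths
(`exists_indistinguishable_continuous`), which is also a Lévy process.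
-/

namespace MacroDim

/-! ### Hitting probabilities and occupation times along a discrete grid -/

/-- A discrete occupation-time estimate. If the walk `S` has increments independent of its past,
and if at each of the `m` steps from `i` on it is likely to be within distance `1` of `S i`,
then hitting `U` forces on average at least `m / 2` visits to a `1`-neighbourhood `V` of `U`.
The events "`U` is hit for the first time at step `i`" are decoupled from the later increments. -/
lemma measure_hit_mul_le_sum_measure_mem {Ω E : Type*} [MeasurableSpace Ω] {P : Measure Ω}
    [NormedAddCommGroup E] [MeasurableSpace E] [BorelSpace E] [SecondCountableTopology E]
    {S : ℕ → Ω → E} (hS : ∀ i, Measurable (S i)) {U V : Set E} (hU : MeasurableSet U)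
    (hV : MeasurableSet V) (hUV : ∀ y ∈ U, ∀ x, ‖x - y‖ ≤ 1 → x ∈ V) (N m : ℕ)
    (hind : ∀ i l, i ≤ l →
      IndepFun (fun ω (j : Finset.range (i + 1)) => S j ω) (fun ω => S l ω - S i ω) P)
    (hsmall : ∀ i l, i ≤ l → l < i + m → 2⁻¹ ≤ P {ω | ‖S l ω - S i ω‖ ≤ 1}) :
    P {ω | ∃ i < N, S i ω ∈ U} * (m * 2⁻¹) ≤ ∑ l ∈ Finset.range (N + m), P {ω | S l ω ∈ V} := by
  classical
  set A : ℕ → Set Ω := fun i => {ω | S i ω ∈ U ∧ ∀ j < i, S j ω ∉ U} with hA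
  have hAm : ∀ i, MeasurableSet (A i) := by
    intro i
    have : A i = (S i ⁻¹' U) ∩ ⋂ j, ⋂ (_ : j < i), (S j ⁻¹' U)ᶜ := by
      ext ω; simp [hA]
    rw [this]
    exact (hS i hU).inter (MeasurableSet.iInter fun j => MeasurableSet.iInter fun _ => (hS j hU).compl)
  have hAd : ∀ i j, i ≠ j → Disjoint (A i) (A j) := by
    intro i j hij
    rw [Set.disjoint_left]
    rintro ω ⟨h1, h2⟩ ⟨h3, h4⟩
    rcases lt_or_gt_of_ne hij with h | h
    · exact h4 i h h1
    · exact h2 j h h3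
  have hcover : {ω | ∃ i < N, S i ω ∈ U} ⊆ ⋃ i ∈ Finset.range N, A i := by
    rintro ω ⟨i, hi, hiU⟩
    have hex : ∃ i, S i ω ∈ U := ⟨i, hiU⟩
    simp only [Set.mem_iUnion]
    exact ⟨Nat.find hex, Finset.mem_range.2 ((Nat.find_min' hex hiU).trans_lt hi),
      Nat.find_spec hex, fun j hj => Nat.find_min hex hj⟩
  have hstep : ∀ i l, i ≤ l → l < i + m → P (A i) * 2⁻¹ ≤ P (A i ∩ {ω | S l ω ∈ V}) := by
    intro i l hil hlm
    set a : Set (Finset.range (i + 1) → E) :=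
      {x | ∀ j : Finset.range (i + 1), ((j : ℕ) = i → x j ∈ U) ∧ ((j : ℕ) < i → x j ∉ U)} with ha
    have ham : MeasurableSet a := by
      have : a = ⋂ j : Finset.range (i + 1), ({x | (j : ℕ) = i → x j ∈ U} ∩
          {x | (j : ℕ) < i → x j ∉ U}) := by
        ext x; simp [ha]
      rw [this]
      refine MeasurableSet.iInter fun j => MeasurableSet.inter ?_ ?_
      · by_cases h : (j : ℕ) = i
        · simp only [h, forall_const]
          exact measurable_pi_apply j hU
        · simp [h]
      · by_cases h : (j : ℕ) < i
        · simp only [h, forall_const]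
          exact (measurable_pi_apply j hU).compl
        · simp [h]
    have hAa : A i = (fun ω (j : Finset.range (i + 1)) => S j ω) ⁻¹' a := by
      ext ω
      constructor
      · rintro ⟨h1, h2⟩ j
        exact ⟨fun h => by simpa [h] using h1, fun h => h2 j h⟩
      · intro h
        exact ⟨(h ⟨i, by simp⟩).1 rfl, fun j hj => (h ⟨j, by simp; omega⟩).2 hj⟩
    have hb : MeasurableSet {x : E | ‖x‖ ≤ 1} := measurableSet_le measurable_norm measurable_const
    have key := (hind i l hil).measure_inter_preimage_eq_mul a {x : E | ‖x‖ ≤ 1} ham hb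
    calc P (A i) * 2⁻¹ ≤ P (A i) * P {ω | ‖S l ω - S i ω‖ ≤ 1} := by
          gcongr; exact hsmall i l hil hlm
      _ = P (A i ∩ {ω | ‖S l ω - S i ω‖ ≤ 1}) := by
          rw [hAa]; exact key.symm
      _ ≤ P (A i ∩ {ω | S l ω ∈ V}) := by
          refine measure_mono fun ω hω => ⟨hω.1, hUV _ hω.1.1 _ hω.2⟩
  calc P {ω | ∃ i < N, S i ω ∈ U} * (m * 2⁻¹)
      ≤ (∑ i ∈ Finset.range N, P (A i)) * (m * 2⁻¹) := by
        gcongr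
        exact (measure_mono hcover).trans (measure_biUnion_finset_le _ _)
    _ = ∑ i ∈ Finset.range N, ∑ l ∈ Finset.Ico i (i + m), P (A i) * 2⁻¹ := by
        rw [Finset.sum_mul]
        refine Finset.sum_congr rfl fun i _ => ?_
        simp; ring
    _ ≤ ∑ i ∈ Finset.range N, ∑ l ∈ Finset.Ico i (i + m), P (A i ∩ {ω | S l ω ∈ V}) := by
        refine Finset.sum_le_sum fun i _ => Finset.sum_le_sum fun l hl => ?_
        rw [Finset.mem_Ico] at hl
        exact hstep i l hl.1 hl.2
    _ ≤ ∑ i ∈ Finset.range N, ∑ l ∈ Finset.range (N + m), P (A i ∩ {ω | S l ω ∈ V}) := by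
        refine Finset.sum_le_sum fun i hi => Finset.sum_le_sum_of_subset fun l hl => ?_
        simp only [Finset.mem_Ico, Finset.mem_range] at *
        omega
    _ = ∑ l ∈ Finset.range (N + m), ∑ i ∈ Finset.range N, P (A i ∩ {ω | S l ω ∈ V}) :=
        Finset.sum_comm
    _ ≤ ∑ l ∈ Finset.range (N + m), P {ω | S l ω ∈ V} := by
        refine Finset.sum_le_sum fun l _ => ?_
        rw [← measure_biUnion_finset]
        · exact measure_mono (by simp)
        · intro i _ j _ hij
          exact (hAd i j hij).mono Set.inter_subset_left Set.inter_subset_left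
        · exact fun i _ => (hAm i).inter (hS l hV)

/-! ### Enlarged lattice cubes -/

/-- The half-open unit cube with lower corner `z`, enlarged by `a` in every direction. -/
def fatCube {d : ℕ} (z : Fin d → ℤ) (a : ℝ) : Set (EuclideanSpace ℝ (Fin d)) :=
  {x | ∀ i, x i ∈ Set.Ico ((z i : ℝ) - a) (z i + 1 + a)}

lemma measurableSet_fatCube {d : ℕ} (z : Fin d → ℤ) (a : ℝ) : MeasurableSet (fatCube z a) := by
  have : fatCube z a = ⋂ i, (fun x : EuclideanSpace ℝ (Fin d) => x i) ⁻¹'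
      Set.Ico ((z i : ℝ) - a) (z i + 1 + a) := by
    ext x; simp [fatCube]
  rw [this]
  exact MeasurableSet.iInter fun i => (by fun_prop : Measurable _) measurableSet_Ico

lemma mem_fatCube_of_norm_sub_le {d : ℕ} {z : Fin d → ℤ} {a r : ℝ}
    {x y : EuclideanSpace ℝ (Fin d)} (hy : y ∈ fatCube z a) (hxy : ‖x - y‖ ≤ r) :
    x ∈ fatCube z (a + r) := by
  intro i
  have h1 := (PiLp.norm_apply_le (x - y) i).trans hxy
  have h3 := hy i
  rw [Real.norm_eq_abs, PiLp.sub_apply] at h1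
  have := abs_le.1 h1
  exact ⟨by linarith [h3.1], by linarith [h3.2]⟩

/-- A point lies in at most `5 ^ d` of the unit lattice cubes enlarged by `2`. -/
lemma sum_indicator_fatCube_le {d : ℕ} (F : Finset (Fin d → ℤ)) (x : EuclideanSpace ℝ (Fin d)) :
    ∑ z ∈ F, (fatCube z 2).indicator (1 : EuclideanSpace ℝ (Fin d) → ℝ≥0∞) x ≤ 5 ^ d := by
  classical
  set G : Finset (Fin d → ℤ) := Fintype.piFinset fun i => Finset.Icc (⌊x i⌋ - 2) (⌊x i⌋ + 2)
  have hG : G.card = 5 ^ d := by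
    simp only [G, Fintype.card_piFinset, Int.card_Icc]
    rw [Finset.prod_congr rfl (g := fun _ => 5) (fun i _ => by omega)]
    simp
  calc ∑ z ∈ F, (fatCube z 2).indicator (1 : EuclideanSpace ℝ (Fin d) → ℝ≥0∞) x
      ≤ ∑ z ∈ F, if z ∈ G then 1 else 0 := by
        refine Finset.sum_le_sum fun z _ => ?_
        by_cases hz : x ∈ fatCube z 2
        swap
        · simp [hz]
        rw [if_pos]
        · simp [hz]
        · simp only [G, Fintype.mem_piFinset, Finset.mem_Icc]
          intro i
          have h := hz i
          have h1 : z i ≤ ⌊x i + 2⌋ := Int.le_floor.2 (by linarith [h.1])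
          have h2 : ⌊x i⌋ < z i + 3 := Int.floor_lt.2 (by push_cast; linarith [h.2])
          have h3 : ⌊x i + 2⌋ = ⌊x i⌋ + 2 := by exact_mod_cast Int.floor_add_intCast (x i) 2
          omega
    _ = ((F ∩ G).card : ℝ≥0∞) := by simp
    _ ≤ (G.card : ℝ≥0∞) := by exact_mod_cast Finset.card_le_card Finset.inter_subset_right
    _ = 5 ^ d := by rw [hG]; push_cast; rfl

lemma sum_measure_mem_fatCube_le {Ω : Type*} [MeasurableSpace Ω] {P : Measure Ω}
    [IsProbabilityMeasure P] {d : ℕ} {Y : Ω → EuclideanSpace ℝ (Fin d)} (hY : Measurable Y)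
    (F : Finset (Fin d → ℤ)) : ∑ z ∈ F, P {ω | Y ω ∈ fatCube z 2} ≤ 5 ^ d := by
  calc ∑ z ∈ F, P {ω | Y ω ∈ fatCube z 2}
      = ∑ z ∈ F, ∫⁻ ω, (fatCube z 2).indicator (1 : EuclideanSpace ℝ (Fin d) → ℝ≥0∞) (Y ω) ∂P := by
        refine Finset.sum_congr rfl fun z _ => ?_
        exact (lintegral_indicator_one (hY (measurableSet_fatCube z 2))).symm
    _ = ∫⁻ ω, ∑ z ∈ F, (fatCube z 2).indicator (1 : EuclideanSpace ℝ (Fin d) → ℝ≥0∞) (Y ω) ∂P := by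
        rw [lintegral_finsetSum]
        exact fun z _ => (measurable_one.indicator (measurableSet_fatCube z 2)).comp hY
    _ ≤ ∫⁻ _, 5 ^ d ∂P := lintegral_mono fun ω => sum_indicator_fatCube_le F (Y ω)
    _ = 5 ^ d := by simp

/-! ### Lévy processes: independence of the past and small increments -/

section LevyIncrements

variable {Ω : Type*} [MeasurableSpace Ω] {P : Measure Ω} {d : ℕ}
  {X : ℝ≥0 → Ω → EuclideanSpace ℝ (Fin d)}

/-- Along a monotone sequence of times, an increment of a Lévy process is independent of the
values of the process up to the beginning of the increment. -/
lemma IsLevyProcess.indepFun_past (hX : IsLevyProcess X P) {s : ℕ → ℝ≥0} (hs : Monotone s)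
    {i l : ℕ} (hil : i ≤ l) :
    IndepFun (fun ω (j : Finset.range (i + 1)) => X (s j) ω)
      (fun ω => X (s l) ω - X (s i) ω) P := by
  -- the times `0, s 0, …, s i, s l, s l, …`
  set t : ℕ → ℝ≥0 := fun j => if j = 0 then 0 else if j ≤ i + 1 then s (j - 1) else s l with ht
  have htm : Monotone t := by
    refine monotone_nat_of_le_succ fun n => ?_
    simp only [ht]
    rcases n with _ | n
    · simp
    · simp only [Nat.add_eq_zero_iff, one_ne_zero, and_false, if_false, Nat.add_sub_cancel]
      split_ifs
      · exact hs (by omega)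
      · exact hs (by omega)
      · omega
      · exact le_rfl
  have hI := hX.indep.nat htm
  have hfin := hI.indepFun_finset (Finset.range (i + 1)) {i + 1} (by simp)
    (fun n => (hX.measurable _).sub (hX.measurable _))
  -- the values of the process are partial sums of its increments
  set φ : (Finset.range (i + 1) → EuclideanSpace ℝ (Fin d)) →
      (Finset.range (i + 1) → EuclideanSpace ℝ (Fin d)) :=
    fun x j => ∑ n ∈ (Finset.range (i + 1)).attach.filter
      (fun n : Finset.range (i + 1) => (n : ℕ) ≤ j), x n with hφ
  have hφm : Measurable φ := by
    refine measurable_pi_lambda _ fun j => Finset.measurable_sum _ fun n _ => measurable_pi_apply n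
  have hcomp := hfin.comp hφm (measurable_pi_apply (⟨i + 1, by simp⟩ : ({i + 1} : Finset ℕ)))
  refine hcomp.congr ?_ ?_
  · filter_upwards [hX.zero] with ω hω
    funext j
    have hj : (j : ℕ) < i + 1 := Finset.mem_range.1 j.2
    simp only [Function.comp, hφ]
    have : ∑ n ∈ (Finset.range (i + 1)).attach.filter (fun n : Finset.range (i + 1) => (n : ℕ) ≤ j),
        (X (t (n + 1)) ω - X (t n) ω) = ∑ n ∈ Finset.range (j + 1),
        (X (t (n + 1)) ω - X (t n) ω) := by
      refine Finset.sum_bij (fun n _ => (n : ℕ)) ?_ ?_ ?_ ?_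
      · intro a ha
        simp at ha ⊢; omega
      · intro a _ b _ h
        exact Subtype.ext h
      · intro b hb
        simp at hb
        exact ⟨⟨b, by simp; omega⟩, by simp; omega, rfl⟩
      · intros; rfl
    rw [this, Finset.sum_range_sub (fun n => X (t n) ω)]
    have h1 : t (j + 1) = s j := by simp [ht]; omega
    have h0 : t 0 = 0 := by simp [ht]
    rw [h1, h0, hω, sub_zero]
  · refine Eventually.of_forall fun ω => ?_
    simp only [Function.comp]
    have h1 : t (i + 1 + 1) = s l := by simp [ht]
    have h0 : t (i + 1) = s i := by simp [ht]
    rw [h1, h0]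

lemma IsLevyProcess.measure_norm_sub_le (hX : IsLevyProcess X P) {s t : ℝ≥0} (hst : s ≤ t) :
    P {ω | ‖X t ω - X s ω‖ ≤ 1} = P {ω | ‖X (t - s) ω‖ ≤ 1} := by
  have h := (hX.stationary s (t - s)).measure_mem_eq
    (measurableSet_le measurable_norm measurable_const : MeasurableSet
      {x : EuclideanSpace ℝ (Fin d) | ‖x‖ ≤ 1})
  rw [add_tsub_cancel_of_le hst] at h
  exact h

/-- Right-continuity at time `0` makes small displacements likely over a short time. -/
lemma IsLevyProcess.exists_half_le_measure_norm_le [IsProbabilityMeasure P]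
    (hX : IsLevyProcess X P) :
    ∃ q : ℕ, ∀ t : ℝ≥0, t ≤ (2 ^ q)⁻¹ → 2⁻¹ ≤ P {ω | ‖X t ω‖ ≤ 1} := by
  by_contra! hcon
  choose t ht hlt using hcon
  have ht0 : Tendsto t atTop (𝓝 0) := by
    refine tendsto_of_tendsto_of_tendsto_of_le_of_le tendsto_const_nhds ?_ (fun _ => zero_le) ht
    exact tendsto_inv_atTop_zero.comp
      (tendsto_pow_atTop_atTop_of_one_lt (one_lt_two : (1 : ℝ≥0) < 2))
  have hm := tendstoInMeasure_of_tendsto_ae (μ := P) (f := fun n => X (t n)) (g := fun _ => 0)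
    (fun n => (hX.measurable _).aestronglyMeasurable) (by
      filter_upwards [hX.zero, hX.cadlag] with ω h0 hc
      have := (hc 0).1
      have hIci : Set.Ici (0 : ℝ≥0) = Set.univ := by ext; simp
      rw [hIci, continuousWithinAt_univ] at this
      have := this.tendsto.comp ht0
      rwa [h0] at this)
  have h1 := hm 1 one_pos
  have hlim : Tendsto (fun n => P {ω | 1 ≤ edist (X (t n) ω) 0} ) atTop (𝓝 0) := h1
  obtain ⟨n, hn⟩ := (hlim.eventually (gt_mem_nhds (by simp : (0 : ℝ≥0∞) < 2⁻¹))).exists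
  have hms : MeasurableSet {ω | ‖X (t n) ω‖ ≤ 1} :=
    measurableSet_le (hX.measurable _).norm measurable_const
  have hc : P {ω | ‖X (t n) ω‖ ≤ 1}ᶜ ≤ P {ω | 1 ≤ edist (X (t n) ω) 0} := by
    refine measure_mono fun ω hω => ?_
    simp only [Set.mem_compl_iff, Set.mem_ofPred_eq, not_le] at hω ⊢
    rw [edist_dist, dist_zero_right, ← ENNReal.ofReal_one]
    exact ENNReal.ofReal_le_ofReal hω.le
  have htot := prob_add_prob_compl (μ := P) hms
  have : P {ω | ‖X (t n) ω‖ ≤ 1} + P {ω | ‖X (t n) ω‖ ≤ 1}ᶜ < 2⁻¹ + 2⁻¹ :=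
    ENNReal.add_lt_add (hlt n) (hc.trans_lt hn)
  rw [htot, ENNReal.inv_two_add_inv_two] at this
  exact lt_irrefl _ this

end LevyIncrements

/-! ### The expected number of lattice cubes visited in unit time -/

section VisitedCubes

variable {Ω : Type*} {d : ℕ}
  {X : ℝ≥0 → Ω → EuclideanSpace ℝ (Fin d)}

/-- The event that `X` visits the unit cube at `z`, enlarged by `1`, at some dyadic time of
`[k, k + 1)`. For right-continuous paths it contains the event that `X` visits the unit cube itself
at any time of `[k, k + 1)`; the restriction to dyadic times keeps it measurable. -/
def hits (X : ℝ≥0 → Ω → EuclideanSpace ℝ (Fin d)) (k : ℕ) (z : Fin d → ℤ) : Set Ω :=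
  {ω | ∃ p i : ℕ, i < 2 ^ p ∧ X (k + i / 2 ^ p) ω ∈ fatCube z 1}

/-- The number of enlarged unit cubes visited by `X` at dyadic times of `[k, k + 1)`. -/
noncomputable def hitCount (X : ℝ≥0 → Ω → EuclideanSpace ℝ (Fin d)) (k : ℕ) (ω : Ω) : ℝ≥0∞ :=
  ∑' z : Fin d → ℤ, (hits X k z).indicator 1 ω

lemma encard_hits_eq_hitCount (X : ℝ≥0 → Ω → EuclideanSpace ℝ (Fin d)) (k : ℕ) (ω : Ω) :
    (({z | ω ∈ hits X k z}.encard : ℕ∞) : ℝ≥0∞) = hitCount X k ω := by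
  rw [← ENNReal.tsum_set_one, tsum_subtype {z | ω ∈ hits X k z} (fun _ => (1 : ℝ≥0∞))]
  rfl

lemma mem_hits_of_mem_unitCube {ω : Ω} {t : ℝ≥0}
    (hc : ContinuousWithinAt (fun t => X t ω) (Set.Ici t) t) {k : ℕ} (hk : (k : ℝ≥0) ≤ t)
    (hk' : t < k + 1) {z : Fin d → ℤ} (hz : X t ω ∈ unitCube (latticePt z)) :
    ω ∈ hits X k z := by
  obtain ⟨ε, hε, hball⟩ := Metric.continuousWithinAt_iff.1 hc 1 one_pos
  have hgap : 0 < min ε ((k : ℝ) + 1 - t) := by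
    refine lt_min hε ?_
    have : (t : ℝ) < k + 1 := by exact_mod_cast hk'
    linarith
  obtain ⟨p, hp⟩ := exists_pow_lt_of_lt_one hgap (by norm_num : (2⁻¹ : ℝ) < 1)
  have hkr : (k : ℝ) ≤ t := by exact_mod_cast hk
  -- the first dyadic time of level `p` after `t`
  set i : ℕ := ⌈((t : ℝ) - k) * 2 ^ p⌉₊ with hi
  have h2p : (0 : ℝ) < 2 ^ p := by positivity
  have hi1 : ((t : ℝ) - k) * 2 ^ p ≤ i := Nat.le_ceil _
  have hi2 : (i : ℝ) < ((t : ℝ) - k) * 2 ^ p + 1 :=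
    Nat.ceil_lt_add_one (mul_nonneg (by linarith) h2p.le)
  have hinv : (2⁻¹ : ℝ) ^ p * 2 ^ p = 1 := by rw [← mul_pow]; norm_num
  have hts : t ≤ k + (i : ℝ≥0) / 2 ^ p := by
    rw [← NNReal.coe_le_coe]
    push_cast
    rw [← sub_le_iff_le_add', le_div_iff₀ h2p]
    exact hi1
  have hst : (i : ℝ) / 2 ^ p < t - k + 2⁻¹ ^ p := by
    rw [div_lt_iff₀ h2p, add_mul, hinv]
    exact hi2
  refine ⟨p, i, ?_, ?_⟩
  · have : (i : ℝ) / 2 ^ p < 1 := by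
      have := hp.trans_le (min_le_right _ _)
      linarith
    rw [div_lt_one h2p] at this
    exact_mod_cast this
  · have hd := hball (x := k + (i : ℝ≥0) / 2 ^ p) hts (by
      rw [NNReal.dist_eq]
      push_cast
      have hts' : (t : ℝ) ≤ k + (i : ℝ) / 2 ^ p := by exact_mod_cast hts
      rw [abs_of_nonneg (by linarith)]
      have := hp.trans_le (min_le_left _ _)
      linarith)
    have h0 : X t ω ∈ fatCube z 0 := by
      intro j
      simpa [latticePt] using hz j
    rw [dist_eq_norm] at hd
    simpa using mem_fatCube_of_norm_sub_le h0 hd.le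

variable [MeasurableSpace Ω] {P : Measure Ω}

lemma measurableSet_hits (hX : ∀ t, Measurable (X t)) (k : ℕ) (z : Fin d → ℤ) :
    MeasurableSet (hits X k z) := by
  have : hits X k z = ⋃ p : ℕ, ⋃ i : ℕ, ⋃ (_ : i < 2 ^ p),
      X (k + i / 2 ^ p) ⁻¹' fatCube z 1 := by
    ext ω; simp [hits]
  rw [this]
  exact MeasurableSet.iUnion fun p => MeasurableSet.iUnion fun i => MeasurableSet.iUnion fun _ =>
    hX _ (measurableSet_fatCube z 1)

lemma measurable_hitCount (hX : ∀ t, Measurable (X t)) (k : ℕ) : Measurable (hitCount X k) :=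
  Measurable.tsum fun z => measurable_one.indicator (measurableSet_hits hX k z)

lemma IsLevyProcess.sum_measure_hits_dyadic_le [IsProbabilityMeasure P] (hX : IsLevyProcess X P)
    {q : ℕ} (hq : ∀ t : ℝ≥0, t ≤ (2 ^ q)⁻¹ → 2⁻¹ ≤ P {ω | ‖X t ω‖ ≤ 1}) (k r : ℕ)
    (F : Finset (Fin d → ℤ)) :
    ∑ z ∈ F, P {ω | ∃ i < 2 ^ (q + r), X (k + (i : ℕ) / 2 ^ (q + r)) ω ∈ fatCube z 1} ≤
      2 * ((2 ^ q + 1) * 5 ^ d) := by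
  set s : ℕ → ℝ≥0 := fun i => k + (i : ℝ≥0) / 2 ^ (q + r) with hs
  have hsm : Monotone s := fun i j hij => by
    simp only [hs]; gcongr
  have hz : ∀ z : Fin d → ℤ,
      P {ω | ∃ i < 2 ^ (q + r), X (s i) ω ∈ fatCube z 1} * (((2 ^ r : ℕ) : ℝ≥0∞) * 2⁻¹) ≤
        ∑ l ∈ Finset.range (2 ^ (q + r) + 2 ^ r), P {ω | X (s l) ω ∈ fatCube z 2} := by
    intro z
    refine measure_hit_mul_le_sum_measure_mem (S := fun i => X (s i)) (fun i => hX.measurable _)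
      (measurableSet_fatCube z 1) (measurableSet_fatCube z 2) (fun y hy x hxy => ?_) _ _
      (fun i l hil => hX.indepFun_past hsm hil) (fun i l hil hlm => ?_)
    · have := mem_fatCube_of_norm_sub_le hy hxy
      norm_num at this
      exact this
    · rw [hX.measure_norm_sub_le (hsm hil)]
      refine hq _ ?_
      rw [tsub_le_iff_left]
      simp only [hs]
      have h2 : ((2 : ℝ≥0) ^ q)⁻¹ = 2 ^ r / 2 ^ (q + r) := by
        rw [pow_add]; field_simp
      rw [h2, add_assoc, ← add_div]
      gcongr
      exact_mod_cast hlm.le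
  set b : ℝ≥0∞ := ((2 ^ r : ℕ) : ℝ≥0∞) with hb
  have hb0 : b ≠ 0 := by simp [hb]
  have hbt : b ≠ ∞ := by simp [hb]
  have hsum : (∑ z ∈ F, P {ω | ∃ i < 2 ^ (q + r), X (s i) ω ∈ fatCube z 1}) * (b * 2⁻¹) ≤
      b * ((2 ^ q + 1) * 5 ^ d) := by
    rw [Finset.sum_mul]
    calc _ ≤ ∑ z ∈ F, ∑ l ∈ Finset.range (2 ^ (q + r) + 2 ^ r), P {ω | X (s l) ω ∈ fatCube z 2} :=
          Finset.sum_le_sum fun z _ => hz z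
      _ = ∑ l ∈ Finset.range (2 ^ (q + r) + 2 ^ r), ∑ z ∈ F, P {ω | X (s l) ω ∈ fatCube z 2} :=
          Finset.sum_comm
      _ ≤ ∑ l ∈ Finset.range (2 ^ (q + r) + 2 ^ r), 5 ^ d :=
          Finset.sum_le_sum fun l _ => sum_measure_mem_fatCube_le (hX.measurable _) F
      _ = b * ((2 ^ q + 1) * 5 ^ d) := by
          simp only [Finset.sum_const, Finset.card_range, nsmul_eq_mul, hb]
          push_cast
          ring
  have hc : (∑ z ∈ F, P {ω | ∃ i < 2 ^ (q + r), X (s i) ω ∈ fatCube z 1}) * 2⁻¹ ≤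
      (2 ^ q + 1) * 5 ^ d := by
    refine (ENNReal.mul_le_mul_iff_right hb0 hbt).1 (le_trans (le_of_eq ?_) hsum)
    ring
  calc _ = 2 * ((∑ z ∈ F, P {ω | ∃ i < 2 ^ (q + r), X (s i) ω ∈ fatCube z 1}) * 2⁻¹) := by
        rw [mul_comm _ (2⁻¹ : ℝ≥0∞), ← mul_assoc,
          ENNReal.mul_inv_cancel two_ne_zero ENNReal.ofNat_ne_top, one_mul]
    _ ≤ _ := by gcongr

/-- The expected number of cubes visited in unit time is bounded by a constant depending only on
the dimension and on how long the process is likely to stay near its starting point. -/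
lemma IsLevyProcess.lintegral_hitCount_le [IsProbabilityMeasure P] (hX : IsLevyProcess X P)
    {q : ℕ} (hq : ∀ t : ℝ≥0, t ≤ (2 ^ q)⁻¹ → 2⁻¹ ≤ P {ω | ‖X t ω‖ ≤ 1}) (k : ℕ) :
    ∫⁻ ω, hitCount X k ω ∂P ≤ 2 * ((2 ^ q + 1) * 5 ^ d) := by
  set D : (Fin d → ℤ) → ℕ → Set Ω := fun z p =>
    {ω | ∃ i < 2 ^ p, X (k + (i : ℕ) / 2 ^ p) ω ∈ fatCube z 1} with hD
  have hmono : ∀ z, Monotone (D z) := by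
    refine fun z => monotone_nat_of_le_succ fun p => ?_
    rintro ω ⟨i, hi, h⟩
    refine ⟨2 * i, by rw [pow_succ]; omega, ?_⟩
    convert h using 3
    push_cast
    rw [pow_succ]
    field_simp
  have hU : ∀ z, hits X k z = ⋃ r, D z (q + r) := by
    intro z
    ext ω
    simp only [Set.mem_iUnion]
    constructor
    · rintro ⟨p, i, hi, h⟩
      exact ⟨p, hmono z (Nat.le_add_left p q) ⟨i, hi, h⟩⟩
    · rintro ⟨r, i, hi, h⟩
      exact ⟨q + r, i, hi, h⟩
  unfold hitCount
  rw [lintegral_tsum fun z =>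
    (measurable_one.indicator (measurableSet_hits hX.measurable k z)).aemeasurable,
    ENNReal.tsum_eq_iSup_sum]
  refine iSup_le fun F => ?_
  have hlim : Tendsto (fun r => ∑ z ∈ F, P (D z (q + r))) atTop (𝓝 (∑ z ∈ F, P (hits X k z))) := by
    refine tendsto_finsetSum _ fun z _ => ?_
    rw [hU]
    exact tendsto_measure_iUnion_atTop fun r r' h => hmono z (by omega)
  calc _ = ∑ z ∈ F, P (hits X k z) := Finset.sum_congr rfl fun z _ =>
        lintegral_indicator_one (measurableSet_hits hX.measurable k z)
    _ ≤ _ := le_of_tendsto' hlim fun r => hX.sum_measure_hits_dyadic_le hq k r F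

end VisitedCubes

/-! ### The macroscopic Minkowski dimension of the graph of a centred Lévy process -/

section MacroscopicDimension

variable {Ω : Type*} {d : ℕ} {X : ℝ≥0 → Ω → EuclideanSpace ℝ (Fin d)}

lemma finite_preimage_box {m : ℕ} (r : ℝ) :
    (latticePt ⁻¹' box (0 : EuclideanSpace ℝ (Fin m)) r).Finite := by
  refine (Fintype.piFinset fun _ : Fin m => Finset.Icc (-⌈r⌉) ⌈r⌉).finite_toSet.subset fun z hz => ?_
  simp only [Finset.mem_coe, Fintype.mem_piFinset, Finset.mem_Icc]
  intro i
  have h := hz i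
  simp only [latticePt, PiLp.zero_apply, zero_sub, zero_add, Set.mem_Ico] at h
  have h1 := Int.le_ceil r
  constructor
  · have : -(⌈r⌉ : ℝ) ≤ z i := by linarith
    exact_mod_cast this
  · have : (z i : ℝ) ≤ ⌈r⌉ := by linarith
    exact_mod_cast this

lemma mem_pix_graph_iff {ω : Ω} {y : Fin (d + 1) → ℤ} :
    y ∈ pix (graph X ω) ↔ ∃ t : ℝ≥0, (t : ℝ) ∈ Set.Ico (y 0 : ℝ) (y 0 + 1) ∧
      X t ω ∈ unitCube (latticePt (Fin.tail y)) := by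
  constructor
  · rintro ⟨_, ⟨t, rfl⟩, h⟩
    refine ⟨t, by simpa [spaceTime, latticePt] using h 0, fun i => ?_⟩
    simpa [spaceTime, latticePt, Fin.tail] using h i.succ
  · rintro ⟨t, h0, h⟩
    refine ⟨_, ⟨t, rfl⟩, fun i => ?_⟩
    refine Fin.cases ?_ (fun i => ?_) i
    · simpa [spaceTime, latticePt] using h0
    · simpa [spaceTime, latticePt, Fin.tail] using h i

lemma encard_pix_graph_inter_box_le {ω : Ω} (hc : IsCadlag fun t => X t ω) (n : ℕ) :
    (((pix (graph X ω) ∩ latticePt ⁻¹' box 0 (2 ^ n)).encard : ℕ∞) : ℝ≥0∞) ≤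
      ∑ k ∈ Finset.range (2 ^ n), hitCount X k ω := by
  have hsub : pix (graph X ω) ∩ latticePt ⁻¹' box 0 (2 ^ n) ⊆
      ⋃ k ∈ Finset.range (2 ^ n),
        (fun z : Fin d → ℤ => (Fin.cons (k : ℤ) z : Fin (d + 1) → ℤ)) '' {z | ω ∈ hits X k z} := by
    rintro y ⟨hy, hb⟩
    obtain ⟨t, ht, hXt⟩ := mem_pix_graph_iff.1 hy
    have hb0 := (hb 0).2
    simp only [latticePt, PiLp.zero_apply, zero_add] at hb0
    have h0 : 0 ≤ y 0 := by
      have : (-1 : ℝ) < y 0 := by linarith [ht.2, t.coe_nonneg]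
      have : (-1 : ℤ) < y 0 := by exact_mod_cast this
      omega
    obtain ⟨k, hk⟩ := Int.eq_ofNat_of_zero_le h0
    rw [hk] at ht hb0
    simp only [Set.mem_iUnion]
    refine ⟨k, ?_, Fin.tail y, ?_, ?_⟩
    · rw [Finset.mem_range]
      exact_mod_cast hb0
    · exact mem_hits_of_mem_unitCube (hc t).1 (by exact_mod_cast ht.1) (by exact_mod_cast ht.2) hXt
    · simp only [← hk]
      exact Fin.cons_self_tail y
  calc (((pix (graph X ω) ∩ latticePt ⁻¹' box 0 (2 ^ n)).encard : ℕ∞) : ℝ≥0∞)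
      ≤ ((∑ k ∈ Finset.range (2 ^ n), {z | ω ∈ hits X k z}.encard : ℕ∞) : ℝ≥0∞) := by
        refine ENat.toENNReal_mono ((Set.encard_le_encard hsub).trans
          ((Finset.set_encard_biUnion_le _ _).trans (Finset.sum_le_sum fun k _ => ?_)))
        exact Set.encard_image_le _ _
    _ = ∑ k ∈ Finset.range (2 ^ n), hitCount X k ω := by
        rw [← ENat.toENNRealRingHom_apply, map_sum]
        exact Finset.sum_congr rfl fun k _ => encard_hits_eq_hitCount X k ω

/-- If the process is at sublinear distance from the origin at integer times, its graph eventually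
visits at least one cube of the box of radius `2 ^ n` over each integer time below `2 ^ n`. -/
lemma eventually_two_pow_le_ncard_pix {ω : Ω}
    (h : Tendsto (fun n : ℕ => (n : ℝ)⁻¹ • X n ω) atTop (𝓝 0)) :
    ∀ᶠ n : ℕ in atTop,
      2 ^ n ≤ (pix (graph X ω) ∩ latticePt ⁻¹' box 0 (2 ^ n)).ncard := by
  have h1 : ∀ᶠ n : ℕ in atTop, ‖(n : ℝ)⁻¹ • X n ω‖ < 1 / 2 := by
    have := h.norm
    rw [norm_zero] at this
    exact this.eventually (gt_mem_nhds (by norm_num))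
  obtain ⟨K, hK⟩ := eventually_atTop.1 h1
  set M : ℝ := ∑ k ∈ Finset.range (K + 1), ‖X k ω‖ with hM
  have hpow : Tendsto (fun n : ℕ => (2 : ℝ) ^ n) atTop atTop :=
    tendsto_pow_atTop_atTop_of_one_lt one_lt_two
  filter_upwards [hpow.eventually_ge_atTop (M + 2)] with n hn
  have hM0 : 0 ≤ M := Finset.sum_nonneg fun _ _ => norm_nonneg _
  have hbound : ∀ k : ℕ, k < 2 ^ n → ‖X k ω‖ ≤ 2 ^ n - 1 := by
    intro k hk
    have hkr : (k : ℝ) < 2 ^ n := by exact_mod_cast hk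
    by_cases hkK : k ≤ K
    · have : ‖X k ω‖ ≤ M := Finset.single_le_sum (f := fun k : ℕ => ‖X k ω‖)
        (fun _ _ => norm_nonneg _) (Finset.mem_range.2 (by omega))
      linarith
    · have hk0 : (0 : ℝ) < k := by exact_mod_cast (by omega : 0 < k)
      have := hK k (by omega)
      rw [norm_smul, norm_inv, Real.norm_natCast, inv_mul_lt_iff₀ hk0] at this
      linarith
  set f : ℕ → Fin (d + 1) → ℤ := fun k => Fin.cons (k : ℤ) fun i => ⌊X k ω i⌋ with hf
  have hinj : Function.Injective f := by
    intro a b hab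
    have := congrFun hab 0
    simpa [hf] using this
  have hsub : ((Finset.range (2 ^ n)).image f : Set (Fin (d + 1) → ℤ)) ⊆
      pix (graph X ω) ∩ latticePt ⁻¹' box 0 (2 ^ n) := by
    rw [Finset.coe_image]
    rintro _ ⟨k, hk, rfl⟩
    have hk' : k < 2 ^ n := by simpa using hk
    have hkr : (k : ℝ) < 2 ^ n := by exact_mod_cast hk'
    constructor
    · refine mem_pix_graph_iff.2 ⟨k, by simp [hf], fun i => ?_⟩
      simp [hf, latticePt, Fin.tail, Int.floor_le, Int.lt_floor_add_one]
    · intro i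
      refine Fin.cases ?_ (fun i => ?_) i
      · simp only [hf, latticePt, PiLp.zero_apply, Fin.cons_zero, Set.mem_Ico]
        push_cast
        constructor <;> linarith [k.cast_nonneg (α := ℝ)]
      · have hi := (PiLp.norm_apply_le (X k ω) i).trans (hbound k hk')
        rw [Real.norm_eq_abs, abs_le] at hi
        simp only [hf, latticePt, PiLp.zero_apply, Fin.cons_succ, Set.mem_Ico]
        have h3 := Int.floor_le (X k ω i)
        have h4 := Int.lt_floor_add_one (X k ω i)
        constructor <;> linarith [hi.1, hi.2]
  calc 2 ^ n = ((Finset.range (2 ^ n)).image f).card := by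
        rw [Finset.card_image_of_injective _ hinj, Finset.card_range]
    _ = ((Finset.range (2 ^ n)).image f : Set (Fin (d + 1) → ℤ)).ncard :=
        (Set.ncard_coe_finset _).symm
    _ ≤ _ := Set.ncard_le_ncard hsub ((finite_preimage_box _).inter_of_right _)

lemma tendsto_inv_mul_logPlus {a : ℕ → ℕ} {K : ℝ} (hlow : ∀ᶠ n in atTop, 2 ^ n ≤ a n)
    (hup : ∀ n, (a n : ℝ) ≤ K * (n + 1) ^ 2 * 2 ^ n) :
    Tendsto (fun n : ℕ => (n : ℝ)⁻¹ * logPlus (a n)) atTop (𝓝 1) := by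
  set L : ℝ := max K 2 with hL
  have hL0 : 0 < L := lt_max_of_lt_right two_pos
  have hlog : Tendsto (fun n : ℕ => (n : ℝ)⁻¹ * Real.logb 2 (n + 1)) atTop (𝓝 0) := by
    have h1 : Tendsto (fun x : ℝ => Real.log x / x) atTop (𝓝 0) := by
      simpa using Real.isLittleO_log_id_atTop.tendsto_div_nhds_zero
    have h2 : Tendsto (fun n : ℕ => (n : ℝ) + 1) atTop atTop :=
      tendsto_atTop_add_const_right _ _ tendsto_natCast_atTop_atTop
    have h3 : Tendsto (fun n : ℕ => ((n : ℝ) + 1) / n) atTop (𝓝 1) := by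
      have : Tendsto (fun n : ℕ => 1 + (n : ℝ)⁻¹) atTop (𝓝 (1 + 0)) :=
        tendsto_const_nhds.add tendsto_inv_atTop_nhds_zero_nat
      rw [add_zero] at this
      refine this.congr' ?_
      filter_upwards [eventually_gt_atTop 0] with n hn
      have : (n : ℝ) ≠ 0 := by positivity
      field_simp
    have h4 := ((h1.comp h2).mul h3).div_const (Real.log 2)
    simp only [zero_mul, zero_div] at h4
    refine h4.congr' ?_
    filter_upwards [eventually_gt_atTop 0] with n hn
    have : (n : ℝ) ≠ 0 := by positivity
    simp only [Function.comp, Real.logb]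
    field_simp
  have hupper : Tendsto (fun n : ℕ => (n : ℝ)⁻¹ * Real.logb 2 L +
      2 * ((n : ℝ)⁻¹ * Real.logb 2 (n + 1)) + 1) atTop (𝓝 1) := by
    have := (((tendsto_inv_atTop_nhds_zero_nat (𝕜 := ℝ)).mul_const (Real.logb 2 L)).add
      (hlog.const_mul 2)).add_const 1
    simpa using this
  refine tendsto_of_tendsto_of_tendsto_of_le_of_le' tendsto_const_nhds hupper ?_ ?_
  · filter_upwards [hlow, eventually_gt_atTop 0] with n hn hn0
    have hnr : (0 : ℝ) < n := by exact_mod_cast hn0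
    rw [le_inv_mul_iff₀ hnr, mul_one, logPlus, Real.le_logb_iff_rpow_le one_lt_two
      (lt_max_of_lt_right two_pos), Real.rpow_natCast]
    exact le_max_of_le_left (by exact_mod_cast hn)
  · filter_upwards [eventually_gt_atTop 0] with n hn0
    have hnr : (0 : ℝ) < n := by exact_mod_cast hn0
    have hle : max (a n : ℝ) 2 ≤ L * (n + 1) ^ 2 * 2 ^ n := by
      refine max_le ((hup n).trans ?_) ?_
      · gcongr
        exact le_max_left _ _
      · have h1 : (1 : ℝ) ≤ (n + 1) ^ 2 := one_le_pow₀ (by linarith)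
        have h2 : (1 : ℝ) ≤ 2 ^ n := one_le_pow₀ one_le_two
        calc (2 : ℝ) = 2 * 1 * 1 := by norm_num
          _ ≤ L * (n + 1) ^ 2 * 2 ^ n := by
            gcongr
            exact le_max_right _ _
    have : logPlus (a n) ≤ Real.logb 2 L + 2 * Real.logb 2 (n + 1) + n := by
      refine (Real.logb_le_logb_of_le one_lt_two (lt_max_of_lt_right two_pos) hle).trans_eq ?_
      have hn1 : (n : ℝ) + 1 ≠ 0 := by positivity
      rw [Real.logb_mul (by positivity) (by positivity), Real.logb_mul (by positivity)
        (by positivity), Real.logb_pow, Real.logb_pow, Real.logb_self_eq_one one_lt_two]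
      push_cast
      ring
    calc (n : ℝ)⁻¹ * logPlus (a n)
        ≤ (n : ℝ)⁻¹ * (Real.logb 2 L + 2 * Real.logb 2 (n + 1) + n) := by gcongr
      _ = _ := by field_simp

variable [MeasurableSpace Ω] {P : Measure Ω}

lemma IsLevyProcess.ae_tendsto_inv_smul [IsProbabilityMeasure P] (hX : IsLevyProcess X P)
    (hint : Integrable (X 1) P) (hmean : ∫ ω, X 1 ω ∂P = 0) :
    ∀ᵐ ω ∂P, Tendsto (fun n : ℕ => (n : ℝ)⁻¹ • X n ω) atTop (𝓝 0) := by
  set Y : ℕ → Ω → EuclideanSpace ℝ (Fin d) :=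
    fun i ω => X ((i + 1 : ℕ) : ℝ≥0) ω - X (i : ℝ≥0) ω with hY
  have hident : ∀ i, IdentDistrib (Y i) (X 1) P P := by
    intro i
    have := hX.stationary i 1
    simpa [hY] using this
  have hind : iIndepFun Y P := hX.indep.nat (t := fun i : ℕ => (i : ℝ≥0)) Nat.mono_cast
  have hlaw := strong_law_ae Y ((hident 0).integrable_iff.2 hint)
    (fun i j hij => hind.indepFun hij) (fun i => (hident i).trans (hident 0).symm)
  rw [(hident 0).integral_eq, hmean] at hlaw
  filter_upwards [hlaw, hX.zero] with ω h h0
  refine h.congr fun n => ?_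
  rw [Finset.sum_range_sub (fun i : ℕ => X (i : ℝ≥0) ω), Nat.cast_zero, h0, sub_zero]

lemma IsLevyProcess.ae_exists_sum_hitCount_le [IsProbabilityMeasure P] (hX : IsLevyProcess X P) :
    ∀ᵐ ω ∂P, ∃ K : ℝ, ∀ n : ℕ, ∑ k ∈ Finset.range (2 ^ n), hitCount X k ω ≤
      ENNReal.ofReal (K * (n + 1) ^ 2 * 2 ^ n) := by
  obtain ⟨q, hq⟩ := hX.exists_half_le_measure_norm_le
  set C : ℝ≥0∞ := 2 * ((2 ^ q + 1) * 5 ^ d) with hC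
  have hCt : C ≠ ∞ := by
    simp only [hC]
    finiteness
  set w : ℕ → ℝ≥0∞ := fun n => ENNReal.ofReal ((n + 1) ^ 2 * 2 ^ n) with hw
  have hw0 : ∀ n, w n ≠ 0 := fun n => by
    simp only [hw, ne_eq, ENNReal.ofReal_eq_zero, not_le]; positivity
  have hwt : ∀ n, w n ≠ ∞ := fun n => ENNReal.ofReal_ne_top
  -- the normalized counts have a summable sequence of expectations
  have hmeas : ∀ n, Measurable fun ω => (w n)⁻¹ * ∑ k ∈ Finset.range (2 ^ n), hitCount X k ω :=
    fun n => (Finset.measurable_sum _ fun k _ => measurable_hitCount hX.measurable k).const_mul _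
  have hexp : ∫⁻ ω, ∑' n, (w n)⁻¹ * ∑ k ∈ Finset.range (2 ^ n), hitCount X k ω ∂P ≠ ∞ := by
    rw [lintegral_tsum fun n => (hmeas n).aemeasurable]
    have hle : ∀ n : ℕ, ∫⁻ ω, (w n)⁻¹ * ∑ k ∈ Finset.range (2 ^ n), hitCount X k ω ∂P ≤
        C * ENNReal.ofReal (1 / ((n : ℝ) + 1) ^ 2) := by
      intro n
      rw [lintegral_const_mul _ (Finset.measurable_sum _ fun k _ =>
        measurable_hitCount hX.measurable k), lintegral_finsetSum _ fun k _ =>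
        measurable_hitCount hX.measurable k]
      calc (w n)⁻¹ * ∑ k ∈ Finset.range (2 ^ n), ∫⁻ ω, hitCount X k ω ∂P
          ≤ (w n)⁻¹ * ∑ k ∈ Finset.range (2 ^ n), C := by
            gcongr
            exact hX.lintegral_hitCount_le hq _
        _ = C * ((w n)⁻¹ * ENNReal.ofReal (2 ^ n)) := by
            rw [Finset.sum_const, Finset.card_range, nsmul_eq_mul,
              ENNReal.ofReal_pow zero_le_two]
            push_cast
            rw [ENNReal.ofReal_ofNat]
            ring
        _ = C * ENNReal.ofReal (1 / ((n : ℝ) + 1) ^ 2) := by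
            simp only [hw]
            rw [← ENNReal.ofReal_inv_of_pos (by positivity), ← ENNReal.ofReal_mul (by positivity)]
            congr 2
            field_simp
    refine ne_top_of_le_ne_top ?_ (ENNReal.tsum_le_tsum hle)
    rw [ENNReal.tsum_mul_left]
    refine ENNReal.mul_ne_top hCt ?_
    have hs : Summable fun n : ℕ => 1 / ((n : ℝ) + 1) ^ 2 := by
      have := (summable_nat_add_iff 1).2 (Real.summable_one_div_nat_pow.2 (one_lt_two))
      simpa using this
    rw [← ENNReal.ofReal_tsum_of_nonneg (fun n => by positivity) hs]
    exact ENNReal.ofReal_ne_top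
  filter_upwards [ae_lt_top (Measurable.tsum hmeas) hexp] with ω hω
  refine ⟨(∑' n, (w n)⁻¹ * ∑ k ∈ Finset.range (2 ^ n), hitCount X k ω).toReal, fun n => ?_⟩
  have h1 := ENNReal.le_tsum (f := fun n => (w n)⁻¹ * ∑ k ∈ Finset.range (2 ^ n), hitCount X k ω) n
  rw [mul_assoc, ENNReal.ofReal_mul ENNReal.toReal_nonneg, ENNReal.ofReal_toReal hω.ne]
  calc ∑ k ∈ Finset.range (2 ^ n), hitCount X k ω
      = ((w n)⁻¹ * ∑ k ∈ Finset.range (2 ^ n), hitCount X k ω) * w n := by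
        rw [mul_comm, ← mul_assoc, ENNReal.mul_inv_cancel (hw0 n) (hwt n), one_mul]
    _ ≤ _ := by gcongr

/-- The graph of an integrable centred Lévy process has macroscopic Minkowski dimension `1`. -/
theorem IsLevyProcess.ae_dimM_graph_eq_one [IsProbabilityMeasure P] (hX : IsLevyProcess X P)
    (hint : Integrable (X 1) P) (hmean : ∫ ω, X 1 ω ∂P = 0) :
    ∀ᵐ ω ∂P, dimM (graph X ω) = 1 := by
  filter_upwards [hX.ae_tendsto_inv_smul hint hmean, hX.ae_exists_sum_hitCount_le, hX.cadlag]
    with ω hlim hK hc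
  obtain ⟨K, hK⟩ := hK
  have hfin : ∀ n : ℕ, (pix (graph X ω) ∩ latticePt ⁻¹' box 0 (2 ^ n)).Finite :=
    fun n => (finite_preimage_box _).inter_of_right _
  have hup : ∀ n : ℕ, ((pix (graph X ω) ∩ latticePt ⁻¹' box 0 (2 ^ n)).ncard : ℝ) ≤
      max K 0 * (n + 1) ^ 2 * 2 ^ n := by
    intro n
    have h1 := (encard_pix_graph_inter_box_le hc n).trans (hK n)
    rw [← (hfin n).cast_ncard_eq, ENat.toENNReal_coe, ← ENNReal.ofReal_natCast] at h1
    refine (ENNReal.ofReal_le_ofReal_iff (by positivity)).1 (h1.trans (ENNReal.ofReal_le_ofReal ?_))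
    gcongr
    exact le_max_left _ _
  have := tendsto_inv_mul_logPlus (eventually_two_pow_le_ncard_pix hlim) hup
  exact ((continuous_coe_real_ereal.tendsto 1).comp this).limsup_eq

end MacroscopicDimension

/-! ### Brownian motion as a Lévy process -/

section BrownianAsLevy

variable {Ω : Type*} [MeasurableSpace Ω] {P : Measure Ω} {B Y : ℝ≥0 → Ω → ℝ}

/-- A Brownian motion is indistinguishable from one with measurable coordinates all of whose paths
are continuous: on the complement of a measurable null set, keep the path; elsewhere, replace it
by `0`. -/
lemma exists_indistinguishable_continuous (hB : IsBrownianReal B P) :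
    ∃ Y : ℝ≥0 → Ω → ℝ, IsBrownianReal Y P ∧ (∀ t, Measurable (Y t)) ∧
      (∀ ω, Continuous fun t => Y t ω) ∧ ∀ᵐ ω ∂P, ∀ t, B t ω = Y t ω := by
  classical
  set q := TopologicalSpace.denseSeq ℝ≥0 with hq
  have hgood : ∀ᵐ ω ∂P, Continuous (fun t => B t ω) ∧
      ∀ n, B (q n) ω = (hB.aemeasurable (q n)).mk _ ω :=
    hB.cont.and (ae_all_iff.2 fun n => (hB.aemeasurable (q n)).ae_eq_mk)
  obtain ⟨N, hsub, hNm, hN0⟩ := exists_measurable_superset_of_null (ae_iff.1 hgood)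
  have hgoodN : ∀ ω, ω ∉ N → Continuous (fun t => B t ω) ∧
      ∀ n, B (q n) ω = (hB.aemeasurable (q n)).mk _ ω := by
    intro ω hω
    by_contra h
    exact hω (hsub h)
  set Y : ℝ≥0 → Ω → ℝ := fun t ω => if ω ∈ N then 0 else B t ω with hY
  have hYc : ∀ ω, Continuous fun t => Y t ω := by
    intro ω
    by_cases h : ω ∈ N
    · simp only [hY, h, if_true]; exact continuous_const
    · simpa [hY, h] using (hgoodN ω h).1
  have hBY : ∀ᵐ ω ∂P, ∀ t, B t ω = Y t ω := by
    have : ∀ᵐ ω ∂P, ω ∉ N := measure_eq_zero_iff_ae_notMem.1 hN0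
    filter_upwards [this] with ω hω t
    simp [hY, hω]
  have hYq : ∀ n, Measurable (Y (q n)) := by
    intro n
    have : Y (q n) = fun ω => if ω ∈ N then 0 else (hB.aemeasurable (q n)).mk _ ω := by
      funext ω
      by_cases h : ω ∈ N
      · simp [hY, h]
      · simp [hY, h, (hgoodN ω h).2 n]
    rw [this]
    exact Measurable.ite hNm measurable_const (hB.aemeasurable (q n)).measurable_mk
  refine ⟨Y, ⟨hB.toIsPreBrownianReal.congr fun t => ?_, Eventually.of_forall hYc⟩, fun t => ?_,
    hYc, hBY⟩
  · filter_upwards [hBY] with ω h using h t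
  · obtain ⟨u, hu, hut⟩ := mem_closure_iff_seq_limit.1
      ((TopologicalSpace.denseRange_denseSeq ℝ≥0) t)
    refine measurable_of_tendsto_metrizable (f := fun n => Y (u n)) (fun n => ?_)
      (tendsto_pi_nhds.2 fun ω => ((hYc ω).tendsto t).comp hut)
    obtain ⟨m, hm⟩ := hu n
    rw [← hm]
    exact hYq m

/-- The identification of `ℝ` with `EuclideanSpace ℝ (Fin 1)`, as a continuous linear map. -/
noncomputable def toVec : ℝ →L[ℝ] EuclideanSpace ℝ (Fin 1) :=
  ((PiLp.continuousLinearEquiv 2 ℝ (fun _ : Fin 1 => ℝ)).symm :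
    (Fin 1 → ℝ) →L[ℝ] EuclideanSpace ℝ (Fin 1)).comp
      (ContinuousLinearMap.pi fun _ => ContinuousLinearMap.id ℝ ℝ)

@[simp] lemma toVec_apply (x : ℝ) (i : Fin 1) : toVec x i = x := rfl

@[simp] lemma norm_toVec (x : ℝ) : ‖toVec x‖ = |x| := by
  simp [EuclideanSpace.norm_eq, Real.sqrt_sq_eq_abs]

lemma toVec_eval_zero (v : EuclideanSpace ℝ (Fin 1)) : toVec (v 0) = v := by
  ext i
  rw [Subsingleton.elim i 0, toVec_apply]

lemma isLevyProcess_toVec (hY : IsBrownianReal Y P) (hm : ∀ t, Measurable (Y t)) :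
    IsLevyProcess (fun t ω => toVec (Y t ω)) P where
  measurable t := toVec.continuous.measurable.comp (hm t)
  zero := by
    filter_upwards [hY.eval_zero_ae_eq_zero] with ω h
    rw [h, map_zero]
  indep := hY.hasIndepIncrements.map toVec
  stationary s t := by
    have h1 := hY.hasLaw_sub (s + t) s
    have h2 : nndist (s + t : ℝ≥0).1 s.1 = t := by
      ext
      simp
    rw [h2] at h1
    have h3 := (h1.identDistrib (hY.hasLaw_eval t)).comp toVec.continuous.measurable
    convert! h3 using 1
  cadlag := by
    filter_upwards [hY.cont] with ω h t
    have hc : Continuous fun t => toVec (Y t ω) := toVec.continuous.comp h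
    exact ⟨hc.continuousWithinAt, _, (hc.tendsto t).mono_left nhdsWithin_le_nhds⟩

lemma integrable_toVec (hY : IsBrownianReal Y P) (t : ℝ≥0) :
    Integrable (fun ω => toVec (Y t ω)) P :=
  toVec.integrable_comp (hY.integrable_eval t)

lemma integral_toVec (hY : IsBrownianReal Y P) (t : ℝ≥0) : ∫ ω, toVec (Y t ω) ∂P = 0 := by
  rw [toVec.integral_comp_comm (hY.integrable_eval t), hY.integral_eval t, map_zero]

lemma measure_norm_toVec_le (hY : IsBrownianReal Y P) (t : ℝ≥0) :
    P {ω | ‖toVec (Y t ω)‖ ≤ 1} = gaussianReal 0 t {x | |x| ≤ 1} := by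
  have hms : MeasurableSet {x : ℝ | |x| ≤ 1} := measurableSet_le (by fun_prop) measurable_const
  have h := hY.hasLaw_eval t
  rw [← h.map_eq, Measure.map_apply_of_aemeasurable h.aemeasurable hms]
  simp

end BrownianAsLevy

/-! ### Upper bound for the Hausdorff dimension of the Brownian graph -/

section UpperBound

variable {Ω : Type*} {Y : ℝ≥0 → Ω → ℝ}

/-- The Brownian rescaling `t ↦ 2 ^ n * Y (t / 4 ^ n)`, as a process in `ℝ¹`. A unit square of its
space-time corresponds to a rectangle of size `4 ^ (-n) × 2 ^ (-n)` for `Y`. -/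
noncomputable def rescale (Y : ℝ≥0 → Ω → ℝ) (n : ℕ) : ℝ≥0 → Ω → EuclideanSpace ℝ (Fin 1) :=
  fun t ω => toVec (2 ^ n * Y ((4 ^ n)⁻¹ * t) ω)

/-- The square of side `4 ^ (-n)` which is the `j`-th one from below in the rectangle
`[k / 4 ^ n, (k + 1) / 4 ^ n] × [z / 2 ^ n, (z + 1) / 2 ^ n]`. -/
def coverSquare (n k : ℕ) (z : Fin 1 → ℤ) (j : ℕ) : Set (EuclideanSpace ℝ (Fin 2)) :=
  {y | y 0 ∈ Set.Icc ((k : ℝ) / 4 ^ n) ((k + 1) / 4 ^ n) ∧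
    y 1 ∈ Set.Icc ((z 0 : ℝ) / 2 ^ n + j / 4 ^ n) ((z 0 : ℝ) / 2 ^ n + (j + 1) / 4 ^ n)}

lemma dist_le_abs_add_abs (x y : EuclideanSpace ℝ (Fin 2)) :
    dist x y ≤ |x 0 - y 0| + |x 1 - y 1| := by
  rw [EuclideanSpace.dist_eq, Fin.sum_univ_two, Real.sqrt_le_left (by positivity), Real.dist_eq,
    Real.dist_eq]
  nlinarith [abs_nonneg (x 0 - y 0), abs_nonneg (x 1 - y 1),
    mul_nonneg (abs_nonneg (x 0 - y 0)) (abs_nonneg (x 1 - y 1))]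

lemma ediam_coverSquare_le (n k : ℕ) (z : Fin 1 → ℤ) (j : ℕ) :
    Metric.ediam (coverSquare n k z j) ≤ ENNReal.ofReal (2 / 4 ^ n) := by
  refine Metric.ediam_le fun x hx y hy => ?_
  rw [edist_dist]
  refine ENNReal.ofReal_le_ofReal ((dist_le_abs_add_abs x y).trans ?_)
  have h0 : |x 0 - y 0| ≤ 1 / 4 ^ n := by
    have := Set.abs_sub_le_of_uIcc_subset_uIcc (Set.uIcc_subset_uIcc
      (Set.Icc_subset_uIcc hx.1) (Set.Icc_subset_uIcc hy.1))
    refine (abs_sub_comm _ _).trans_le (this.trans_eq ?_)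
    rw [← sub_div, add_sub_cancel_left, abs_of_nonneg (by positivity)]
  have h1 : |x 1 - y 1| ≤ 1 / 4 ^ n := by
    have := Set.abs_sub_le_of_uIcc_subset_uIcc (Set.uIcc_subset_uIcc
      (Set.Icc_subset_uIcc hx.2) (Set.Icc_subset_uIcc hy.2))
    refine (abs_sub_comm _ _).trans_le (this.trans_eq ?_)
    rw [add_sub_add_left_eq_sub, ← sub_div, add_sub_cancel_left, abs_of_nonneg (by positivity)]
  calc |x 0 - y 0| + |x 1 - y 1| ≤ 1 / 4 ^ n + 1 / 4 ^ n := add_le_add h0 h1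
    _ = 2 / 4 ^ n := by ring

/-- The graph over `[0, M)` is covered by the squares lying in the visited rectangles. -/
lemma graph_Iio_subset_iUnion_coverSquare {ω : Ω} (hc : Continuous fun t => Y t ω) (M n : ℕ) :
    (fun t : ℝ≥0 => spaceTime t (toVec (Y t ω))) '' Set.Iio (M : ℝ≥0) ⊆
      ⋃ i : Fin (M * 4 ^ n) × (Fin 1 → ℤ) × Fin (2 ^ n),
        {y | y ∈ coverSquare n i.1 i.2.1 i.2.2 ∧ ω ∈ hits (rescale Y n) i.1 i.2.1} := by
  rintro _ ⟨t, ht, rfl⟩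
  have h4 : (0 : ℝ≥0) < 4 ^ n := by positivity
  have h4r : (0 : ℝ) < 4 ^ n := by positivity
  have h2r : (0 : ℝ) < 2 ^ n := by positivity
  have h42 : (4 : ℝ) ^ n = 2 ^ n * 2 ^ n := by rw [← mul_pow]; norm_num
  set k := ⌊4 ^ n * t⌋₊ with hk
  set x : ℝ := Y t ω with hx
  set z : Fin 1 → ℤ := fun _ => ⌊2 ^ n * x⌋ with hz
  set v : ℝ := (2 ^ n * x - ⌊2 ^ n * x⌋) * 2 ^ n with hv
  have hv0 : 0 ≤ v := mul_nonneg (sub_nonneg.2 (Int.floor_le _)) h2r.le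
  have hv1 : v < 2 ^ n := by
    have := Int.lt_floor_add_one (2 ^ n * x)
    calc v < 1 * 2 ^ n := by
          simp only [hv]; gcongr; linarith
      _ = 2 ^ n := one_mul _
  have hkt : (k : ℝ≥0) ≤ 4 ^ n * t := Nat.floor_le zero_le
  have hkt' : 4 ^ n * t < (k : ℝ≥0) + 1 := Nat.lt_floor_add_one _
  have hktr : (k : ℝ) ≤ 4 ^ n * t := by exact_mod_cast hkt
  have hktr' : 4 ^ n * (t : ℝ) < k + 1 := by exact_mod_cast hkt'
  have hkM : k < M * 4 ^ n := by
    rw [hk, Nat.floor_lt zero_le]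
    push_cast
    rw [mul_comm (M : ℝ≥0)]
    exact mul_lt_mul_of_pos_left ht h4
  have hj : ⌊v⌋₊ < 2 ^ n := by
    rw [Nat.floor_lt hv0]
    exact_mod_cast hv1
  have hxv : x = ⌊2 ^ n * x⌋ / 2 ^ n + v / 4 ^ n := by
    rw [h42, hv]
    field_simp
    ring
  simp only [Set.mem_iUnion]
  refine ⟨(⟨k, hkM⟩, z, ⟨⌊v⌋₊, hj⟩), ⟨⟨⟨?_, ?_⟩, ⟨?_, ?_⟩⟩, ?_⟩⟩
  · change (k : ℝ) / 4 ^ n ≤ (t : ℝ)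
    rwa [div_le_iff₀' h4r]
  · change (t : ℝ) ≤ (k + 1) / 4 ^ n
    rw [le_div_iff₀' h4r]
    exact hktr'.le
  · change (⌊2 ^ n * x⌋ : ℝ) / 2 ^ n + (⌊v⌋₊ : ℝ) / 4 ^ n ≤ x
    nth_rw 2 [hxv]
    gcongr
    exact Nat.floor_le hv0
  · change x ≤ (⌊2 ^ n * x⌋ : ℝ) / 2 ^ n + ((⌊v⌋₊ : ℝ) + 1) / 4 ^ n
    nth_rw 1 [hxv]
    gcongr
    exact (Nat.lt_floor_add_one v).le
  · have hcont : Continuous fun t => rescale Y n t ω := by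
      unfold rescale
      fun_prop
    refine mem_hits_of_mem_unitCube hcont.continuousWithinAt hkt hkt' fun i => ?_
    have : (4 ^ n : ℝ≥0)⁻¹ * (4 ^ n * t) = t := by field_simp
    simp only [rescale, this, toVec_apply, latticePt, hz, ← hx]
    exact ⟨Int.floor_le _, Int.lt_floor_add_one _⟩

variable [MeasurableSpace Ω] {P : Measure Ω}

lemma isBrownianReal_rescale (hY : IsBrownianReal Y P) (n : ℕ) :
    IsBrownianReal (fun t ω => 2 ^ n * Y ((4 ^ n)⁻¹ * t) ω) P := by
  have h := hY.smul (c := (4 ^ n)⁻¹) (by positivity)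
  have hs : (√(((4 ^ n)⁻¹ : ℝ≥0) : ℝ))⁻¹ = 2 ^ n := by
    push_cast
    have h4 : (4 : ℝ) ^ n = (2 ^ n) ^ 2 := by rw [← pow_mul, mul_comm, pow_mul]; norm_num
    rw [Real.sqrt_inv, inv_inv, h4, Real.sqrt_sq (by positivity)]
  rwa [hs] at h

lemma exists_lintegral_hitCount_rescale_le [IsProbabilityMeasure P] (hY : IsBrownianReal Y P)
    (hm : ∀ t, Measurable (Y t)) :
    ∃ C : ℝ≥0∞, C ≠ ∞ ∧ ∀ n k, ∫⁻ ω, hitCount (rescale Y n) k ω ∂P ≤ C := by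
  obtain ⟨q, hq⟩ := (isLevyProcess_toVec hY hm).exists_half_le_measure_norm_le
  refine ⟨2 * ((2 ^ q + 1) * 5 ^ 1), by finiteness, fun n k => ?_⟩
  have hn := isBrownianReal_rescale hY n
  refine (isLevyProcess_toVec hn fun t => (hm _).const_mul _).lintegral_hitCount_le
    (fun t ht => ?_) k
  rw [measure_norm_toVec_le hn, ← measure_norm_toVec_le hY]
  exact hq t ht

/-- Fatou's lemma applied to the covers by visited squares of side `4 ^ (-n)`, of which there are
on average of the order of `8 ^ n`. -/
lemma ae_hausdorffMeasure_graph_Iio_eq_zero [IsProbabilityMeasure P] (hY : IsBrownianReal Y P)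
    (hm : ∀ t, Measurable (Y t)) (hc : ∀ ω, Continuous fun t => Y t ω) (M : ℕ) {s : ℝ}
    (hs : 3 / 2 < s) :
    ∀ᵐ ω ∂P, Measure.hausdorffMeasure s
      ((fun t : ℝ≥0 => spaceTime t (toVec (Y t ω))) '' Set.Iio (M : ℝ≥0)) = 0 := by
  obtain ⟨C, hC, hCn⟩ := exists_lintegral_hitCount_rescale_le hY hm
  have hs0 : 0 < s := by linarith
  set r : ℕ → ℝ≥0∞ := fun n => ENNReal.ofReal (2 / 4 ^ n) with hr
  set cost : ℕ → Ω → ℝ≥0∞ := fun n ω =>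
    (∑ k ∈ Finset.range (M * 4 ^ n), hitCount (rescale Y n) k ω) * (2 ^ n * r n ^ s) with hcost
  have hmr : ∀ n t, Measurable (rescale Y n t) := fun n t =>
    toVec.continuous.measurable.comp ((hm _).const_mul _)
  have hcm : ∀ n, Measurable (cost n) := fun n =>
    (Finset.measurable_sum _ fun k _ => measurable_hitCount (hmr n) k).mul_const _
  have hr0 : Tendsto r atTop (𝓝 0) := by
    rw [← ENNReal.ofReal_zero]
    refine ENNReal.tendsto_ofReal ?_
    exact tendsto_const_nhds.div_atTop (tendsto_pow_atTop_atTop_of_one_lt (by norm_num))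
  have hexp : ∀ n, ∫⁻ ω, cost n ω ∂P ≤
      M * C * ENNReal.ofReal (2 ^ s * (8 * 4 ^ (-s)) ^ n) := by
    intro n
    simp only [hcost]
    rw [lintegral_mul_const _ (Finset.measurable_sum _ fun k _ => measurable_hitCount (hmr n) k),
      lintegral_finsetSum _ fun k _ => measurable_hitCount (hmr n) k]
    calc (∑ k ∈ Finset.range (M * 4 ^ n), ∫⁻ ω, hitCount (rescale Y n) k ω ∂P) * (2 ^ n * r n ^ s)
        ≤ (∑ k ∈ Finset.range (M * 4 ^ n), C) * (2 ^ n * r n ^ s) := by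
          gcongr
          exact hCn _ _
      _ = M * C * (ENNReal.ofReal (4 ^ n) * ENNReal.ofReal (2 ^ n) * r n ^ s) := by
          rw [Finset.sum_const, Finset.card_range, nsmul_eq_mul, ENNReal.ofReal_pow (by norm_num),
            ENNReal.ofReal_pow (by norm_num), ENNReal.ofReal_ofNat, ENNReal.ofReal_ofNat]
          push_cast
          ring
      _ = _ := by
          congr 1
          simp only [hr]
          rw [ENNReal.ofReal_rpow_of_nonneg (by positivity) hs0.le,
            ← ENNReal.ofReal_mul (by positivity), ← ENNReal.ofReal_mul (by positivity)]
          congr 1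
          rw [Real.div_rpow (by norm_num) (by positivity), mul_pow, Real.rpow_neg (by norm_num),
            inv_pow, ← Real.rpow_natCast (4 ^ s), ← Real.rpow_natCast 4 n, ← Real.rpow_mul
            (by norm_num), ← Real.rpow_mul (by norm_num), mul_comm (n : ℝ) s, Real.rpow_natCast,
            show (8 : ℝ) ^ n = 4 ^ n * 2 ^ n by rw [← mul_pow]; norm_num]
          field_simp
  have hlim : Tendsto (fun n => ∫⁻ ω, cost n ω ∂P) atTop (𝓝 0) := by
    have hgeo : Tendsto (fun n : ℕ => (2 : ℝ) ^ s * (8 * 4 ^ (-s)) ^ n) atTop (𝓝 0) := by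
      have h8 : (8 : ℝ) * 4 ^ (-s) < 1 := by
        have h4 : (4 : ℝ) ^ (3 / 2 : ℝ) = 8 := by
          rw [show (4 : ℝ) = 2 ^ (2 : ℝ) by norm_num, ← Real.rpow_mul (by norm_num)]
          norm_num
        have h5 : (8 : ℝ) < 4 ^ s := by
          rw [← h4]
          exact Real.rpow_lt_rpow_of_exponent_lt (by norm_num) hs
        rw [Real.rpow_neg (by norm_num), ← div_eq_mul_inv, div_lt_one (by positivity)]
        exact h5
      simpa using (tendsto_pow_atTop_nhds_zero_of_lt_one (by positivity) h8).const_mul (2 ^ s)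
    have h1 := ENNReal.Tendsto.const_mul (a := M * C) (ENNReal.tendsto_ofReal hgeo)
      (Or.inr (by finiteness))
    rw [ENNReal.ofReal_zero, mul_zero] at h1
    exact tendsto_of_tendsto_of_tendsto_of_le_of_le tendsto_const_nhds h1 (fun _ => zero_le) hexp
  have hfatou : ∫⁻ ω, liminf (fun n => cost n ω) atTop ∂P = 0 := by
    refine le_antisymm ((lintegral_liminf_le hcm).trans_eq hlim.liminf_eq) zero_le
  rw [lintegral_eq_zero_iff (Measurable.liminf hcm)] at hfatou
  filter_upwards [hfatou] with ω hω
  refine le_antisymm ((Measure.hausdorffMeasure_le_liminf_tsum s _ r hr0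
    (fun n (i : Fin (M * 4 ^ n) × (Fin 1 → ℤ) × Fin (2 ^ n)) =>
      {y | y ∈ coverSquare n i.1 i.2.1 i.2.2 ∧ ω ∈ hits (rescale Y n) i.1 i.2.1})
    (Eventually.of_forall fun n i => (Metric.ediam_mono fun y hy => hy.1).trans
      (ediam_coverSquare_le n _ _ _))
    (Eventually.of_forall fun n => graph_Iio_subset_iUnion_coverSquare (hc ω) M n)).trans ?_)
    zero_le
  refine le_trans (liminf_le_liminf (Eventually.of_forall fun n => ?_)) (le_of_eq hω)
  have hterm : ∀ i : Fin (M * 4 ^ n) × (Fin 1 → ℤ) × Fin (2 ^ n),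
      Metric.ediam {y | y ∈ coverSquare n i.1 i.2.1 i.2.2 ∧ ω ∈ hits (rescale Y n) i.1 i.2.1} ^ s ≤
        (hits (rescale Y n) i.1 i.2.1).indicator 1 ω * r n ^ s := by
    intro i
    by_cases h : ω ∈ hits (rescale Y n) i.1 i.2.1
    · simp only [h, and_true, Set.indicator_of_mem, Pi.one_apply, one_mul]
      exact ENNReal.rpow_le_rpow (ediam_coverSquare_le n _ _ _) hs0.le
    · simp [h, hs0]
  calc _ ≤ ∑' i : Fin (M * 4 ^ n) × (Fin 1 → ℤ) × Fin (2 ^ n),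
        (hits (rescale Y n) i.1 i.2.1).indicator (1 : Ω → ℝ≥0∞) ω * r n ^ s :=
        ENNReal.tsum_le_tsum hterm
    _ = cost n ω := by
        rw [ENNReal.tsum_prod', tsum_fintype]
        simp_rw [ENNReal.tsum_prod', tsum_fintype, Finset.sum_const, Finset.card_univ,
          Fintype.card_fin, nsmul_eq_mul, ENNReal.tsum_mul_left, ENNReal.tsum_mul_right]
        rw [← Finset.mul_sum, ← Finset.sum_mul, Fin.sum_univ_eq_sum_range
          (fun k => ∑' z, (hits (rescale Y n) k z).indicator (1 : Ω → ℝ≥0∞) ω) (M * 4 ^ n)]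
        simp only [hcost, hitCount]
        push_cast
        ring

lemma ae_dimH_graph_le [IsProbabilityMeasure P] (hY : IsBrownianReal Y P)
    (hm : ∀ t, Measurable (Y t)) (hc : ∀ ω, Continuous fun t => Y t ω) :
    ∀ᵐ ω ∂P, dimH (graph (fun t ω => toVec (Y t ω)) ω) ≤ 3 / 2 := by
  have h : ∀ᵐ ω ∂P, ∀ M j : ℕ, Measure.hausdorffMeasure (3 / 2 + 1 / ((j : ℝ) + 1))
      ((fun t : ℝ≥0 => spaceTime t (toVec (Y t ω))) '' Set.Iio (M : ℝ≥0)) = 0 :=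
    ae_all_iff.2 fun M => ae_all_iff.2 fun j =>
      ae_hausdorffMeasure_graph_Iio_eq_zero hY hm hc M (lt_add_of_pos_right _ (by positivity))
  filter_upwards [h] with ω hω
  have hU : graph (fun t ω => toVec (Y t ω)) ω =
      ⋃ M : ℕ, (fun t : ℝ≥0 => spaceTime t (toVec (Y t ω))) '' Set.Iio (M : ℝ≥0) := by
    rw [← Set.image_iUnion, graph, ← Set.image_univ]
    congr 1
    refine (Set.eq_univ_of_forall fun t => ?_).symm
    obtain ⟨M, hM⟩ := exists_nat_gt t
    exact Set.mem_iUnion.2 ⟨M, hM⟩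
  rw [hU, dimH_iUnion]
  refine iSup_le fun M => ?_
  have hlim : Tendsto (fun j : ℕ => ((3 / 2 + 1 / ((j : ℝ≥0) + 1) : ℝ≥0) : ℝ≥0∞)) atTop
      (𝓝 (((3 / 2 + 0 : ℝ≥0)) : ℝ≥0∞)) := by
    refine ENNReal.tendsto_coe.2 (tendsto_const_nhds.add ?_)
    exact tendsto_one_div_add_atTop_nhds_zero_nat
  have h32 : (((3 / 2 + 0 : ℝ≥0)) : ℝ≥0∞) = 3 / 2 := by
    rw [add_zero, ENNReal.coe_div two_ne_zero]; rfl
  rw [h32] at hlim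
  refine ge_of_tendsto' hlim fun j => dimH_le_of_hausdorffMeasure_ne_top ?_
  have := hω M j
  push_cast
  rw [this]
  exact ENNReal.zero_ne_top

end UpperBound

/-! ### The energy method for lower bounds on the Hausdorff dimension -/

section Energy

/-- A set carrying a nonzero finite measure `μ` of finite `s`-energy has Hausdorff dimension at
least `s`: on a set of positive measure the `s`-potential of `μ` is bounded by a constant `M`, so
there `μ` is at most `M` times the `s`-th power of the diameter. The convention `0 ^ (-s) = ∞` makes
this cover the case of single points. -/
lemma le_dimH_of_energy_ne_top {E : Type*} [EMetricSpace E] [SecondCountableTopology E]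
    [MeasurableSpace E] [BorelSpace E] {μ : Measure E} [IsFiniteMeasure μ] (hμ : μ ≠ 0) {s : ℝ≥0}
    (hs : 0 < s) (henergy : ∫⁻ x, ∫⁻ y, edist x y ^ (-(s : ℝ)) ∂μ ∂μ ≠ ∞) {S : Set E}
    (hS : μ Sᶜ = 0) : (s : ℝ≥0∞) ≤ dimH S := by
  have hsr : (0 : ℝ) < s := hs
  have hker : Measurable fun p : E × E => edist p.1 p.2 ^ (-(s : ℝ)) :=
    measurable_edist.pow_const _
  set φ : E → ℝ≥0∞ := fun x => ∫⁻ y, edist x y ^ (-(s : ℝ)) ∂μ with hφ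
  have hφm : Measurable φ := hker.lintegral_prod_right'
  have hφfin : ∀ᵐ x ∂μ, φ x < ∞ := ae_lt_top hφm henergy
  obtain ⟨M, hM⟩ : ∃ M : ℕ, μ {x | φ x ≤ (M + 1 : ℕ)} ≠ 0 := by
    by_contra! hcon
    have hU : μ (⋃ M : ℕ, {x | φ x ≤ (M + 1 : ℕ)}) = 0 := measure_iUnion_null hcon
    have hall : ∀ᵐ x ∂μ, False := by
      filter_upwards [hφfin, measure_eq_zero_iff_ae_notMem.1 hU] with x h1 h2
      obtain ⟨n, hn⟩ := ENNReal.exists_nat_gt h1.ne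
      refine h2 (Set.mem_iUnion.2 ⟨n, hn.le.trans ?_⟩)
      exact_mod_cast Nat.le_succ n
    rw [ae_iff] at hall
    simp only [not_false_eq_true, Set.ofPred_true, Measure.measure_univ_eq_zero] at hall
    exact hμ hall
  set K : ℝ≥0∞ := ((M + 1 : ℕ) : ℝ≥0∞) with hK
  have hK0 : K ≠ 0 := by simp [hK]
  have hKt : K ≠ ∞ := by simp [hK]
  set A : Set E := {x | φ x ≤ K} with hA
  have hAm : MeasurableSet A := measurableSet_le hφm measurable_const
  have hle : K⁻¹ • μ.restrict A ≤ Measure.hausdorffMeasure (s : ℝ) := by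
    refine Measure.le_hausdorffMeasure _ _ 1 one_pos fun T hT => ?_
    rw [Measure.smul_apply, smul_eq_mul, Measure.restrict_apply' hAm]
    rcases (T ∩ A).eq_empty_or_nonempty with h | ⟨x, hxT, hxA⟩
    · simp [h]
    set ρ := Metric.ediam T with hρ
    have hmarkov : ρ ^ (-(s : ℝ)) * μ T ≤ K := by
      refine le_trans ?_ ((mul_meas_ge_le_lintegral (hker.comp measurable_prodMk_left)
        (ρ ^ (-(s : ℝ)))).trans hxA)
      gcongr
      intro y hy
      simp only [Function.comp, Set.mem_ofPred_eq]
      rw [ENNReal.rpow_neg, ENNReal.rpow_neg, ENNReal.inv_le_inv]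
      exact ENNReal.rpow_le_rpow (Metric.edist_le_ediam_of_mem hxT hy) hsr.le
    have hμT : μ T ≤ K * ρ ^ (s : ℝ) := by
      rw [ENNReal.rpow_neg] at hmarkov
      by_cases h0 : ρ ^ (s : ℝ) = 0
      · rw [h0, ENNReal.inv_zero] at hmarkov
        have : μ T = 0 := by
          by_contra hne
          rw [ENNReal.top_mul hne] at hmarkov
          exact hKt (top_le_iff.1 hmarkov)
        simp [this]
      · have ht : ρ ^ (s : ℝ) ≠ ∞ :=
          ENNReal.rpow_ne_top_of_nonneg hsr.le (ne_top_of_le_ne_top ENNReal.one_ne_top hT)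
        rwa [mul_comm, ← div_eq_mul_inv, ENNReal.div_le_iff h0 ht] at hmarkov
    calc K⁻¹ * μ (T ∩ A) ≤ K⁻¹ * (K * ρ ^ (s : ℝ)) := by
          gcongr
          exact (measure_mono Set.inter_subset_left).trans hμT
      _ = ρ ^ (s : ℝ) := by rw [← mul_assoc, ENNReal.inv_mul_cancel hK0 hKt, one_mul]
  refine le_dimH_of_hausdorffMeasure_ne_zero fun h0 => ?_
  have hSA : μ (S ∩ A) = 0 := by
    have := (hle S).trans_eq h0
    rw [Measure.smul_apply, smul_eq_mul, Measure.restrict_apply' hAm, nonpos_iff_eq_zero,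
      mul_eq_zero] at this
    exact this.resolve_left (ENNReal.inv_ne_zero.2 hKt)
  refine hM (le_antisymm ?_ zero_le)
  calc μ A ≤ μ (S ∩ A) + μ Sᶜ :=
        (measure_mono fun x hx => (em (x ∈ S)).imp (fun h => ⟨h, hx⟩) id).trans
          (measure_union_le _ _)
    _ = 0 := by rw [hSA, hS, add_zero]

end Energy

/-! ### Singular integrals -/

/-- The kernel `|x| ^ (-c)`, infinite at `0`. -/
noncomputable def singularKernel (c x : ℝ) : ℝ≥0∞ := ENNReal.ofReal |x| ^ (-c)

lemma measurable_singularKernel (c : ℝ) : Measurable (singularKernel c) := by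
  unfold singularKernel
  fun_prop

lemma singularKernel_neg (c x : ℝ) : singularKernel c (-x) = singularKernel c x := by
  simp [singularKernel]

lemma lintegral_singularKernel_Icc_zero_one_ne_top {c : ℝ} (hc : c < 1) :
    ∫⁻ x in Set.Icc 0 1, singularKernel c x ≠ ∞ := by
  have hint : IntegrableOn (fun x : ℝ => x ^ (-c)) (Set.Ioc 0 1) volume :=
    (intervalIntegrable_iff_integrableOn_Ioc_of_le zero_le_one).1
      (intervalIntegral.intervalIntegrable_rpow' (by linarith))
  rw [← setLIntegral_congr Ioc_ae_eq_Icc]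
  have h := hint.lintegral_lt_top
  rw [setLIntegral_congr_fun measurableSet_Ioc (g := fun x : ℝ => ENNReal.ofReal (x ^ (-c)))]
  · exact h.ne
  · intro x hx
    simp only [singularKernel]
    rw [abs_of_pos hx.1, ENNReal.ofReal_rpow_of_pos hx.1]

lemma lintegral_singularKernel_Icc_neg_one_one_ne_top {c : ℝ} (hc : c < 1) :
    ∫⁻ x in Set.Icc (-1) 1, singularKernel c x ≠ ∞ := by
  have h1 := lintegral_singularKernel_Icc_zero_one_ne_top hc
  have h2 : ∫⁻ x in Set.Icc (-1) 0, singularKernel c x =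
      ∫⁻ x in Set.Icc 0 1, singularKernel c x := by
    rw [← lintegral_indicator measurableSet_Icc, ← lintegral_indicator measurableSet_Icc,
      ← lintegral_neg_eq_self]
    refine lintegral_congr fun x => ?_
    by_cases hx : x ∈ Set.Icc (0 : ℝ) 1
    · have : -x ∈ Set.Icc (-1 : ℝ) 0 := ⟨by linarith [hx.2], by linarith [hx.1]⟩
      rw [Set.indicator_of_mem hx, Set.indicator_of_mem this, singularKernel_neg]
    · have : -x ∉ Set.Icc (-1 : ℝ) 0 := fun h => hx ⟨by linarith [h.2], by linarith [h.1]⟩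
      rw [Set.indicator_of_notMem hx, Set.indicator_of_notMem this]
  have hsub : Set.Icc (-1 : ℝ) 1 ⊆ Set.Icc (-1) 0 ∪ Set.Icc 0 1 := fun x hx =>
    (le_total x 0).imp (fun h => ⟨hx.1, h⟩) (fun h => ⟨h, hx.2⟩)
  refine ne_top_of_le_ne_top ?_ ((lintegral_mono_set hsub).trans (lintegral_union_le _ _ _))
  rw [h2]
  exact ENNReal.add_ne_top.2 ⟨h1, h1⟩

lemma lintegral_lintegral_singularKernel_sub_ne_top {c : ℝ} (hc : c < 1) :
    ∫⁻ t in Set.Icc (0 : ℝ) 1, ∫⁻ r in Set.Icc (0 : ℝ) 1, singularKernel c (t - r) ≠ ∞ := by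
  set J := ∫⁻ x in Set.Icc (-1 : ℝ) 1, singularKernel c x with hJ
  have hle : ∀ t ∈ Set.Icc (0 : ℝ) 1, ∫⁻ r in Set.Icc (0 : ℝ) 1, singularKernel c (t - r) ≤ J := by
    intro t ht
    rw [hJ, ← lintegral_indicator measurableSet_Icc, ← lintegral_indicator measurableSet_Icc,
      ← lintegral_sub_left_eq_self ((Set.Icc (-1 : ℝ) 1).indicator (singularKernel c)) t]
    refine lintegral_mono fun r => Set.indicator_apply_le' (fun hr => ?_) (fun _ => zero_le)
    rw [Set.indicator_of_mem]
    exact ⟨by linarith [ht.1, hr.2], by linarith [ht.2, hr.1]⟩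
  refine ne_top_of_le_ne_top ?_ (setLIntegral_mono measurable_const hle)
  simpa using lintegral_singularKernel_Icc_neg_one_one_ne_top hc

/-- Negative moments of order below `1` of the standard Gaussian are finite: its density is
bounded. -/
lemma lintegral_singularKernel_gaussianReal_ne_top {b : ℝ} (hb0 : 0 < b) (hb : b < 1) :
    ∫⁻ x, singularKernel b x ∂(gaussianReal 0 1) ≠ ∞ := by
  have hpdf : ∀ x, gaussianPDF 0 1 x ≤ 1 := by
    intro x
    rw [gaussianPDF, ← ENNReal.ofReal_one]
    refine ENNReal.ofReal_le_ofReal ?_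
    rw [gaussianPDFReal]
    have h1 : (√(2 * Real.pi * (1 : ℝ≥0)))⁻¹ ≤ 1 := by
      refine inv_le_one_of_one_le₀ (Real.one_le_sqrt.2 ?_)
      push_cast
      linarith [Real.pi_gt_three]
    have h2 : Real.exp (-(x - 0) ^ 2 / (2 * (1 : ℝ≥0))) ≤ 1 := by
      refine Real.exp_le_one_iff.2 (div_nonpos_of_nonpos_of_nonneg ?_ (by positivity))
      linarith [sq_nonneg (x - 0)]
    exact mul_le_one₀ h1 (Real.exp_pos _).le h2
  rw [← lintegral_add_compl _ (measurableSet_Icc : MeasurableSet (Set.Icc (-1 : ℝ) 1))]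
  refine ENNReal.add_ne_top.2 ⟨?_, ?_⟩
  · refine ne_top_of_le_ne_top (lintegral_singularKernel_Icc_neg_one_one_ne_top hb) ?_
    rw [gaussianReal_of_var_ne_zero 0 one_ne_zero, restrict_withDensity measurableSet_Icc,
      lintegral_withDensity_eq_lintegral_mul _ (measurable_gaussianPDF 0 1)
        (measurable_singularKernel b)]
    refine lintegral_mono fun x => ?_
    exact mul_le_of_le_one_left zero_le (hpdf x)
  · refine ne_top_of_le_ne_top (b := ∫⁻ _ in (Set.Icc (-1 : ℝ) 1)ᶜ, 1 ∂(gaussianReal 0 1)) ?_ ?_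
    · simp
    · refine setLIntegral_mono measurable_const fun x hx => ?_
      have h1 : 1 ≤ |x| := by
        by_contra h
        exact hx ⟨(abs_lt.1 (not_le.1 h)).1.le, (abs_lt.1 (not_le.1 h)).2.le⟩
      rw [singularKernel, ENNReal.rpow_neg]
      refine ENNReal.inv_le_one.2 (ENNReal.one_le_rpow ?_ hb0)
      rw [← ENNReal.ofReal_one]
      exact ENNReal.ofReal_le_ofReal h1

/-- Gaussian scaling of the negative moment of order `b`. -/
lemma lintegral_singularKernel_gaussianReal {b : ℝ} {v : ℝ≥0} (hv : v ≠ 0) :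
    ∫⁻ x, singularKernel b x ∂(gaussianReal 0 v) =
      singularKernel (b / 2) v * ∫⁻ x, singularKernel b x ∂(gaussianReal 0 1) := by
  have hv0 : (0 : ℝ) < v := NNReal.coe_pos.2 (pos_of_ne_zero hv)
  have hmap : gaussianReal 0 v = (gaussianReal 0 1).map (√(v : ℝ) * ·) := by
    rw [gaussianReal_map_const_mul, mul_zero]
    congr 1
    ext
    simp
  rw [hmap, lintegral_map (measurable_singularKernel b) (by fun_prop), ← lintegral_const_mul _
    (measurable_singularKernel b)]
  refine lintegral_congr fun x => ?_
  simp only [singularKernel]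
  rw [abs_mul, ENNReal.ofReal_mul (abs_nonneg _), abs_of_nonneg (Real.sqrt_nonneg _),
    abs_of_pos hv0, ENNReal.mul_rpow_of_ne_top ENNReal.ofReal_ne_top ENNReal.ofReal_ne_top]
  congr 1
  rw [Real.sqrt_eq_rpow, ← ENNReal.ofReal_rpow_of_pos hv0, ← ENNReal.rpow_mul]
  congr 1
  ring

/-! ### Lower bound for the Hausdorff dimension of the Brownian graph -/

section LowerBound

variable {Ω : Type*} {Y : ℝ≥0 → Ω → ℝ}

/-- The parametrization of the graph of `Y` by real times (negative times are sent to `0`). -/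
noncomputable def graphPoint (Y : ℝ≥0 → Ω → ℝ) (ω : Ω) (t : ℝ) : EuclideanSpace ℝ (Fin 2) :=
  spaceTime t.toNNReal (toVec (Y t.toNNReal ω))

/-- The exponents are split as `s = (s - b) + b`: the time difference takes the power `s - b` and
the spatial one, whose negative moments exist only below order `1`, the power `b`. -/
lemma edist_graphPoint_rpow_le {ω : Ω} {s b t r : ℝ} (hb : 0 ≤ b) (hbs : b ≤ s) (ht : 0 ≤ t)
    (hr : 0 ≤ r) (htr : t ≠ r) :
    edist (graphPoint Y ω t) (graphPoint Y ω r) ^ (-s) ≤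
      singularKernel (s - b) (t - r) *
        singularKernel b (Y t.toNNReal ω - Y r.toNNReal ω) := by
  set x := edist (graphPoint Y ω t) (graphPoint Y ω r) with hx
  have hcoord : ∀ i, ENNReal.ofReal |graphPoint Y ω t i - graphPoint Y ω r i| ≤ x := by
    intro i
    rw [hx, edist_dist, dist_eq_norm]
    refine ENNReal.ofReal_le_ofReal ?_
    rw [← Real.norm_eq_abs, ← PiLp.sub_apply]
    exact PiLp.norm_apply_le _ i
  have h0 : ENNReal.ofReal |t - r| ≤ x := by
    have := hcoord 0
    simpa [graphPoint, spaceTime, ht, hr] using this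
  have h1 : ENNReal.ofReal |Y t.toNNReal ω - Y r.toNNReal ω| ≤ x := by
    have := hcoord 1
    simpa [graphPoint, spaceTime] using this
  have hx0 : x ≠ 0 := by
    refine ne_of_gt (lt_of_lt_of_le ?_ h0)
    rw [ENNReal.ofReal_pos]
    exact abs_pos.2 (sub_ne_zero.2 htr)
  have hxt : x ≠ ∞ := edist_ne_top _ _
  have hsplit : x ^ (-s) = x ^ (-(s - b)) * x ^ (-b) := by
    rw [← ENNReal.rpow_add _ _ hx0 hxt]
    congr 1
    ring
  rw [hsplit]
  refine mul_le_mul' ?_ ?_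
  · rw [singularKernel, ENNReal.rpow_neg, ENNReal.rpow_neg, ENNReal.inv_le_inv]
    exact ENNReal.rpow_le_rpow h0 (by linarith)
  · rw [singularKernel, ENNReal.rpow_neg, ENNReal.rpow_neg, ENNReal.inv_le_inv]
    exact ENNReal.rpow_le_rpow h1 hb

lemma measurableSet_graph {ω : Ω} (hc : Continuous fun t => Y t ω) :
    MeasurableSet (graph (fun t ω => toVec (Y t ω)) ω) := by
  have : graph (fun t ω => toVec (Y t ω)) ω =
      {y : EuclideanSpace ℝ (Fin 2) | 0 ≤ y 0} ∩
        {y : EuclideanSpace ℝ (Fin 2) | y 1 = Y (y 0).toNNReal ω} := by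
    ext y
    constructor
    · rintro ⟨t, rfl⟩
      refine ⟨t.coe_nonneg, ?_⟩
      change Y t ω = Y (t : ℝ).toNNReal ω
      rw [Real.toNNReal_coe]
    · rintro ⟨h0, h1⟩
      refine ⟨(y 0).toNNReal, ?_⟩
      ext i
      refine Fin.cases ?_ (fun i => ?_) i
      · exact Real.coe_toNNReal _ h0
      · rw [Subsingleton.elim i 0]
        exact h1.symm
  rw [this]
  have h0 : Continuous fun y : EuclideanSpace ℝ (Fin 2) => y 0 := by fun_prop
  have h1 : Continuous fun y : EuclideanSpace ℝ (Fin 2) => y 1 := by fun_prop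
  exact ((isClosed_le continuous_const h0).inter (isClosed_eq h1
    (hc.comp (continuous_real_toNNReal.comp h0)))).measurableSet

variable [MeasurableSpace Ω] {P : Measure Ω}

lemma measurable_graphPoint (hm : ∀ t, Measurable (Y t)) (hc : ∀ ω, Continuous fun t => Y t ω) :
    Measurable fun p : Ω × ℝ => graphPoint Y p.1 p.2 := by
  have hjoint : Measurable fun p : Ω × ℝ => Y p.2.toNNReal p.1 :=
    (measurable_uncurry_of_continuous_of_measurable (u := Y) hc hm).comp
      ((measurable_real_toNNReal.comp measurable_snd).prodMk measurable_fst)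
  refine (WithLp.measurable_toLp 2 _).comp (measurable_pi_lambda _ fun i => ?_)
  refine Fin.cases ?_ (fun i => ?_) i
  · simp only [Fin.cons_zero]
    fun_prop
  · simpa only [Fin.cons_succ, toVec_apply] using hjoint

lemma measurable_edist_graphPoint_rpow (hm : ∀ t, Measurable (Y t))
    (hc : ∀ ω, Continuous fun t => Y t ω) (s : ℝ) :
    Measurable fun p : (Ω × ℝ) × ℝ =>
      edist (graphPoint Y p.1.1 p.1.2) (graphPoint Y p.1.1 p.2) ^ (-s) :=
  (((measurable_graphPoint hm hc).comp measurable_fst).edist ((measurable_graphPoint hm hc).comp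
    ((measurable_fst.comp measurable_fst).prodMk measurable_snd))).pow_const _

lemma measurable_potential_graphPoint (hm : ∀ t, Measurable (Y t))
    (hc : ∀ ω, Continuous fun t => Y t ω) (s : ℝ) :
    Measurable fun p : Ω × ℝ => ∫⁻ r in Set.Icc (0 : ℝ) 1,
      edist (graphPoint Y p.1 p.2) (graphPoint Y p.1 r) ^ (-s) :=
  (measurable_edist_graphPoint_rpow hm hc s).lintegral_prod_right'

lemma lintegral_edist_graphPoint_rpow_le (hY : IsBrownianReal Y P) {s b t r : ℝ} (hb : 0 ≤ b)
    (hbs : b ≤ s) (ht : 0 ≤ t) (hr : 0 ≤ r) (htr : t ≠ r) :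
    ∫⁻ ω, edist (graphPoint Y ω t) (graphPoint Y ω r) ^ (-s) ∂P ≤
      (∫⁻ x, singularKernel b x ∂(gaussianReal 0 1)) * singularKernel (s - b / 2) (t - r) := by
  have htr' : 0 < |t - r| := abs_pos.2 (sub_ne_zero.2 htr)
  have hlaw := hY.hasLaw_sub t.toNNReal r.toNNReal
  have hv : nndist t.toNNReal.1 r.toNNReal.1 = Real.nnabs (t - r) := by
    ext
    rw [coe_nndist, Real.dist_eq, Real.coe_nnabs]
    change |(t.toNNReal : ℝ) - (r.toNNReal : ℝ)| = _
    rw [Real.coe_toNNReal _ ht, Real.coe_toNNReal _ hr]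
  rw [hv] at hlaw
  have hv0 : Real.nnabs (t - r) ≠ 0 := by
    simpa [sub_eq_zero] using htr
  calc ∫⁻ ω, edist (graphPoint Y ω t) (graphPoint Y ω r) ^ (-s) ∂P
      ≤ ∫⁻ ω, singularKernel (s - b) (t - r) *
        singularKernel b (Y t.toNNReal ω - Y r.toNNReal ω) ∂P :=
        lintegral_mono fun ω => edist_graphPoint_rpow_le hb hbs ht hr htr
    _ = singularKernel (s - b) (t - r) *
        ∫⁻ ω, singularKernel b (Y t.toNNReal ω - Y r.toNNReal ω) ∂P := by
        refine lintegral_const_mul' _ _ ?_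
        rw [singularKernel]
        exact ENNReal.rpow_ne_top_of_ne_zero (by simpa using htr') ENNReal.ofReal_ne_top
    _ = singularKernel (s - b) (t - r) *
        ∫⁻ x, singularKernel b x ∂(gaussianReal 0 (Real.nnabs (t - r))) := by
        rw [← hlaw.map_eq, lintegral_map' (measurable_singularKernel b).aemeasurable
          hlaw.aemeasurable]
        rfl
    _ = _ := by
        rw [lintegral_singularKernel_gaussianReal hv0, ← mul_assoc, mul_comm]
        congr 1
        simp only [singularKernel, Real.coe_nnabs, abs_abs]
        rw [← ENNReal.rpow_add _ _ (by simpa using htr') ENNReal.ofReal_ne_top]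
        congr 1
        ring

/-- The occupation measure of the graph over `[0, 1]` has finite `s`-energy for `s < 3 / 2`. -/
lemma lintegral_energy_graphPoint_ne_top [IsProbabilityMeasure P] (hY : IsBrownianReal Y P)
    (hm : ∀ t, Measurable (Y t)) (hc : ∀ ω, Continuous fun t => Y t ω) {s : ℝ} (hs1 : 1 ≤ s)
    (hs : s < 3 / 2) :
    ∫⁻ ω, (∫⁻ t in Set.Icc (0 : ℝ) 1, ∫⁻ r in Set.Icc (0 : ℝ) 1,
      edist (graphPoint Y ω t) (graphPoint Y ω r) ^ (-s)) ∂P ≠ ∞ := by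
  -- an exponent `b < 1` with `s - b / 2 < 1`
  obtain ⟨b, hb⟩ : ∃ b : ℝ, b = s - 1 / 2 := ⟨_, rfl⟩
  have hb0 : 0 < b := by linarith
  have hb1 : b < 1 := by linarith
  have hc1 : s - b / 2 < 1 := by linarith
  have hK := lintegral_singularKernel_gaussianReal_ne_top hb0 hb1
  have hFt : ∀ t, Measurable fun p : Ω × ℝ =>
      edist (graphPoint Y p.1 t) (graphPoint Y p.1 p.2) ^ (-s) := fun t =>
    have h1 : Measurable fun p : Ω × ℝ => graphPoint Y p.1 t :=
      (measurable_graphPoint hm hc).comp (measurable_fst.prodMk measurable_const)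
    (h1.edist (measurable_graphPoint hm hc)).pow_const _
  rw [lintegral_lintegral_swap (measurable_potential_graphPoint hm hc s).aemeasurable]
  have hle : ∀ t ∈ Set.Icc (0 : ℝ) 1, ∫⁻ ω, (∫⁻ r in Set.Icc (0 : ℝ) 1,
      edist (graphPoint Y ω t) (graphPoint Y ω r) ^ (-s)) ∂P ≤
        (∫⁻ x, singularKernel b x ∂(gaussianReal 0 1)) *
          ∫⁻ r in Set.Icc (0 : ℝ) 1, singularKernel (s - b / 2) (t - r) := by
    intro t ht
    rw [lintegral_lintegral_swap (hFt t).aemeasurable, ← lintegral_const_mul' _ _ hK]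
    refine lintegral_mono_ae ?_
    filter_upwards [ae_restrict_mem measurableSet_Icc,
      ae_restrict_of_ae (Measure.ae_ne volume t)] with r hr hrt
    exact lintegral_edist_graphPoint_rpow_le hY hb0.le (by linarith) ht.1 hr.1 hrt.symm
  refine ne_top_of_le_ne_top ?_ (lintegral_mono_ae ((ae_restrict_mem measurableSet_Icc).mono hle))
  rw [lintegral_const_mul' _ _ hK]
  exact ENNReal.mul_ne_top hK (lintegral_lintegral_singularKernel_sub_ne_top hc1)

lemma ae_le_dimH_graph [IsProbabilityMeasure P] (hY : IsBrownianReal Y P)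
    (hm : ∀ t, Measurable (Y t)) (hc : ∀ ω, Continuous fun t => Y t ω) {s : ℝ≥0} (hs1 : 1 ≤ s)
    (hs : s < 3 / 2) :
    ∀ᵐ ω ∂P, (s : ℝ≥0∞) ≤ dimH (graph (fun t ω => toVec (Y t ω)) ω) := by
  have hs1r : (1 : ℝ) ≤ s := by exact_mod_cast hs1
  have hsr : (s : ℝ) < 3 / 2 := by
    have := NNReal.coe_lt_coe.2 hs
    simpa using this
  filter_upwards [ae_lt_top (measurable_potential_graphPoint hm hc s).lintegral_prod_right'
    (lintegral_energy_graphPoint_ne_top hY hm hc hs1r hsr)] with ω hω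
  have hg : Measurable (graphPoint Y ω) :=
    (measurable_graphPoint hm hc).comp measurable_prodMk_left
  have hker : Measurable fun p : EuclideanSpace ℝ (Fin 2) × EuclideanSpace ℝ (Fin 2) =>
      edist p.1 p.2 ^ (-(s : ℝ)) := measurable_edist.pow_const _
  refine le_dimH_of_energy_ne_top (μ := (volume.restrict (Set.Icc (0 : ℝ) 1)).map (graphPoint Y ω))
    ?_ (lt_of_lt_of_le one_pos hs1) ?_ ?_
  · rw [Ne, Measure.map_eq_zero_iff hg.aemeasurable, Measure.restrict_eq_zero]
    simp
  · rw [lintegral_map hker.lintegral_prod_right' hg]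
    refine ne_of_eq_of_ne (lintegral_congr fun t => ?_) hω.ne
    exact lintegral_map (hker.comp measurable_prodMk_left) hg
  · rw [Measure.map_apply hg (measurableSet_graph (hc ω)).compl]
    have : graphPoint Y ω ⁻¹' (graph (fun t ω => toVec (Y t ω)) ω)ᶜ = ∅ :=
      Set.eq_empty_of_forall_notMem fun t ht => ht ⟨t.toNNReal, rfl⟩
    rw [this, measure_empty]

theorem ae_dimH_graph_eq [IsProbabilityMeasure P] (hY : IsBrownianReal Y P)
    (hm : ∀ t, Measurable (Y t)) (hc : ∀ ω, Continuous fun t => Y t ω) :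
    ∀ᵐ ω ∂P, dimH (graph (fun t ω => toVec (Y t ω)) ω) = 3 / 2 := by
  have hlow : ∀ᵐ ω ∂P, ∀ j : ℕ, ((3 / 2 - 1 / ((j : ℝ≥0) + 2) : ℝ≥0) : ℝ≥0∞) ≤
      dimH (graph (fun t ω => toVec (Y t ω)) ω) := by
    refine ae_all_iff.2 fun j => ae_le_dimH_graph hY hm hc ?_ ?_
    · refine le_tsub_of_add_le_right ?_
      have : 1 / ((j : ℝ≥0) + 2) ≤ 1 / 2 := by gcongr; exact le_add_self
      calc (1 : ℝ≥0) + 1 / ((j : ℝ≥0) + 2) ≤ 1 + 1 / 2 := by gcongr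
        _ = 3 / 2 := by norm_num
    · exact tsub_lt_self (by positivity) (by positivity)
  filter_upwards [hlow, ae_dimH_graph_le hY hm hc] with ω h1 h2
  refine le_antisymm h2 ?_
  have hlim : Tendsto (fun j : ℕ => ((3 / 2 - 1 / ((j : ℝ≥0) + 2) : ℝ≥0) : ℝ≥0∞)) atTop
      (𝓝 (((3 / 2 - 0 : ℝ≥0)) : ℝ≥0∞)) := by
    refine ENNReal.tendsto_coe.2 (tendsto_const_nhds.sub ?_)
    have h2 : Tendsto (fun j : ℕ => (j : ℝ≥0) + 2) atTop atTop :=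
      tendsto_atTop_mono (fun _ => le_self_add) tendsto_natCast_atTop_atTop
    simp only [one_div]
    exact tendsto_inv_atTop_zero.comp h2
  have h32 : (((3 / 2 - 0 : ℝ≥0)) : ℝ≥0∞) = 3 / 2 := by
    rw [tsub_zero, ENNReal.coe_div two_ne_zero]; rfl
  rw [h32] at hlim
  exact le_of_tendsto' hlim h1

end LowerBound

end MacroDim

theorem mainTheorem3 {Ω : Type*} [MeasurableSpace Ω] (P : Measure Ω) [IsProbabilityMeasure P] :
    (∀ (d : ℕ) (X : ℝ≥0 → Ω → EuclideanSpace ℝ (Fin d)), MacroDim.IsLevyProcess X P →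
      Integrable (X 1) P → ∫ ω, X 1 ω ∂P = 0 →
      ∀ᵐ ω ∂P, MacroDim.dimM (MacroDim.graph X ω) = 1) ∧
    (∀ B : ℝ≥0 → Ω → EuclideanSpace ℝ (Fin 1), IsBrownianReal (fun t ω => B t ω 0) P →
      ∀ᵐ ω ∂P, MacroDim.dimM (MacroDim.graph B ω) = 1 ∧
        dimH (MacroDim.graph B ω) = 3 / 2) := by
  refine ⟨fun d X hX hint hmean => hX.ae_dimM_graph_eq_one hint hmean, fun B hB => ?_⟩
  obtain ⟨Y, hY, hm, hc, hBY⟩ := MacroDim.exists_indistinguishable_continuous hB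
  filter_upwards [hBY, MacroDim.ae_dimH_graph_eq hY hm hc,
    (MacroDim.isLevyProcess_toVec hY hm).ae_dimM_graph_eq_one (MacroDim.integrable_toVec hY 1)
      (MacroDim.integral_toVec hY 1)] with ω h hH hM
  have : MacroDim.graph B ω = MacroDim.graph (fun t ω => MacroDim.toVec (Y t ω)) ω := by
    unfold MacroDim.graph
    congr 1
    funext t
    change MacroDim.spaceTime t (B t ω) = MacroDim.spaceTime t (MacroDim.toVec (Y t ω))
    rw [← h t, MacroDim.toVec_eval_zero]
  rw [this]
  exact ⟨hM, hH⟩
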